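/- Let $d\ge 2$ be fixed. An instance $(G,w,t)$ consists of a $d$-uniform hypergraph $G=(V,E)$ with $n=|V|\ge 1$ vertices, hyperedge weights $w\colon E\to\mathbb{N}_0$, and a positive integer $t$. A hyperclique is a set $S\subseteq V$ all of whose $d$-element subsets are hyperedges, and its weight is $\sum_{e\in E,\,e\subseteq S}w(e)$. Max-Edge-Weight $d$-Uniform Hyperclique asks whether $G$ has a hyperclique of weight at least $t$, and Exact-Edge-Weight $d$-Uniform Hyperclique asks whether $G$ has a hyperclique of weight exactly $t$. An instance is encoded in binary by $n$, $t$ and its weighted adjacency tensor; its bitsize is the length of the encoding. There is a randomized polynomial-time algorithm that, given an $n$-vertex instance $(G,w,t)$ of Max-Edge-Weight $d$-Uniform Hyperclique, returns a family of $K$ instances $(G_i,w_i,t_i)$, $i\in\{1,\dots,K\}$, of Exact-Edge-Weight $d$-Uniform Hyperclique, each of bitsize $\mathcal{O}(n^{d+1})$, such that 1. $K$ is bounded by a polynomial in the bitsize of $(G,w,t)$; 2. if $(G,w,t)$ is a YES-instance, then (for every outcome of the random bits) at least one instance $(G_i,w_i,t_i)$ is a YES-instance; 3. if $(G,w,t)$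 is a NO-instance, then with probability $1-2^{-\Omega(n)}$ all the instances $(G_i,w_i,t_i)$ are NO-instances. Consequently, Max-Edge-Weight $d$-Uniform Hyperclique parameterized by $n$ has a one-sided-error randomized Turing kernel of size $\mathcal{O}(n^{d+1})$: there is a randomized polynomial-time algorithm which, using an oracle for Exact-Edge-Weight $d$-Uniform Hyperclique that it queries only on instances of bitsize $\mathcal{O}(n^{d+1})$, accepts every YES-instance with certainty and rejects every NO-instance with probability $1-2^{-\Omega(n)}$. The constants hidden in $\mathcal{O}(\cdot)$ and $\Omega(\cdot)$ and the polynomials depend only on $d$. -/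

import Mathlib

/-! ### Weighted uniform hypergraphs -/

/-- An instance `(G, w, t)`: a `d`-uniform hypergraph `G` on the vertex set `Fin n`, non-negative
integer hyperedge weights, and a positive integer target. Only the values of `w` on hyperedges
matter; the others enter neither the encoding nor the two problems below. -/
structure HypercliqueInstance (d : ℕ) where
  n : ℕ
  edges : Finset (Finset (Fin n))
  uniform : ∀ e ∈ edges, e.card = d
  w : Finset (Fin n) → ℕ
  t : ℕ
  t_pos : 0 < t

namespace HypercliqueInstance

variable {d : ℕ}

/-- `S` is a hyperclique: every `d`-subset of `S` is a hyperedge. -/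
def IsHyperclique (I : HypercliqueInstance d) (S : Finset (Fin I.n)) : Prop :=
  ∀ X : Finset (Fin I.n), X ⊆ S → X.card = d → X ∈ I.edges

/-- Total weight of the hyperedges contained in `S`. -/
def weight (I : HypercliqueInstance d) (S : Finset (Fin I.n)) : ℕ :=
  ∑ e ∈ I.edges with e ⊆ S, I.w e

/-- YES-instances of Exact-Edge-Weight `d`-Uniform Hyperclique. -/
def ExactYes (I : HypercliqueInstance d) : Prop :=
  ∃ S : Finset (Fin I.n), I.IsHyperclique S ∧ I.weight S = I.t

/-- YES-instances of Max-Edge-Weight `d`-Uniform Hyperclique. -/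
def MaxYes (I : HypercliqueInstance d) : Prop :=
  ∃ S : Finset (Fin I.n), I.IsHyperclique S ∧ I.t ≤ I.weight S

/-- The entry of the weighted adjacency tensor at the vertex tuple `v`: `0` if the entries of `v`
do not form a hyperedge, and one plus the weight of that hyperedge otherwise. -/
def tensorEntry (I : HypercliqueInstance d) (v : Fin d → Fin I.n) : ℕ :=
  if Finset.image v Finset.univ ∈ I.edges then I.w (Finset.image v Finset.univ) + 1 else 0

/-- An instance written as a sequence of numbers: `n`, `t`, and the `n ^ d` entries of the weighted
adjacency tensor. The tuple in position `k` consists of the `d` base-`n` digits of `k`. -/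
def encode (I : HypercliqueInstance d) : List ℕ :=
  I.n :: I.t :: List.ofFn (fun k : Fin (I.n ^ d) => I.tensorEntry (finFunctionFinEquiv.symm k))

end HypercliqueInstance

/-- Self-delimiting binary code of a sequence of numbers: each binary digit is preceded by a
`true`, and each number is closed by a `false`. -/
def wordBits (x : List ℕ) : List Bool :=
  x.flatMap fun a => (a.bits.flatMap fun b => [true, b]) ++ [false]

/-- The bitsize of an instance: the length of its binary encoding. -/
def HypercliqueInstance.bitsize {d : ℕ} (I : HypercliqueInstance d) : ℕ :=
  (wordBits I.encode).length

/-! ### Random access machines with logarithmic cost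

A machine has number registers and finitely many (those its program mentions) unbounded arrays of
numbers, a sequential input tape, an output tape, a tape of random bits, and an oracle which is
asked about the word that currently stands on the output tape. Numbers are natural numbers of
arbitrary size, and every operation is charged the bit lengths of all numbers it handles. -/

/-- `queries` records the words about which the oracle has been asked. -/
structure RamState where
  reg : ℕ → ℕ
  arr : ℕ → ℕ → ℕ
  input : List ℕ
  output : List ℕ
  coins : List Bool
  queries : List (List ℕ)

/-- Expressions: constants, registers, array cells, and arithmetic. -/
inductive RamExpr where
  | const (c : ℕ)
  | reg (i : ℕ)
  | cell (a : ℕ) (e : RamExpr)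
  | add (e f : RamExpr)
  | sub (e f : RamExpr)
  | mul (e f : RamExpr)
  | div (e f : RamExpr)
  | mod (e f : RamExpr)

/-- Subtraction is truncated, `x / 0 = 0` and `x % 0 = x`. -/
def RamExpr.eval (s : RamState) : RamExpr → ℕ
  | const c => c
  | reg i => s.reg i
  | cell a e => s.arr a (e.eval s)
  | add e f => e.eval s + f.eval s
  | sub e f => e.eval s - f.eval s
  | mul e f => e.eval s * f.eval s
  | div e f => e.eval s / f.eval s
  | mod e f => e.eval s % f.eval s

/-- Logarithmic cost of evaluating an expression: one unit plus the bit length of the value, for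
each of its subexpressions (in particular for each address). -/
def RamExpr.cost (s : RamState) : RamExpr → ℕ
  | const c => 1 + c.size
  | reg i => 1 + (s.reg i).size
  | cell a e => 1 + (s.arr a (e.eval s)).size + e.cost s
  | add e f => 1 + (e.eval s + f.eval s).size + e.cost s + f.cost s
  | sub e f => 1 + (e.eval s - f.eval s).size + e.cost s + f.cost s
  | mul e f => 1 + (e.eval s * f.eval s).size + e.cost s + f.cost s
  | div e f => 1 + (e.eval s / f.eval s).size + e.cost s + f.cost s
  | mod e f => 1 + (e.eval s % f.eval s).size + e.cost s + f.cost s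

/-- Programs. `flip i` puts a random bit into register `i`; `query i` puts the answer of the oracle
to the word on the output tape into register `i` and empties the output tape; tests are for being
nonzero. -/
inductive RamProg where
  | skip
  | assign (i : ℕ) (e : RamExpr)
  | store (a : ℕ) (e f : RamExpr)
  | readIn (i : ℕ)
  | writeOut (e : RamExpr)
  | flip (i : ℕ)
  | query (i : ℕ)
  | seq (p q : RamProg)
  | cond (e : RamExpr) (p q : RamProg)
  | loop (e : RamExpr) (p : RamProg)

def RamState.setReg (s : RamState) (i v : ℕ) : RamState :=
  { s with reg := Function.update s.reg i v }

def RamState.setCell (s : RamState) (a j v : ℕ) : RamState :=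
  { s with arr := Function.update s.arr a (Function.update (s.arr a) j v) }

/-- `RamExec O p s s' c`: with oracle `O`, the program `p` started in state `s` halts in state `s'`
at total cost `c`. The rules are deterministic: randomness enters through the tape of coins only.
At the end of the input tape `0` is read, and at the end of the tape of coins the bit `0`. -/
inductive RamExec (O : List ℕ → Bool) : RamProg → RamState → RamState → ℕ → Prop where
  | skip (s : RamState) : RamExec O .skip s s 1
  | assign (i : ℕ) (e : RamExpr) (s : RamState) :
      RamExec O (.assign i e) s (s.setReg i (e.eval s)) (1 + e.cost s)
  | store (a : ℕ) (e f : RamExpr) (s : RamState) :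
      RamExec O (.store a e f) s (s.setCell a (e.eval s) (f.eval s)) (1 + e.cost s + f.cost s)
  | readIn (i : ℕ) (s : RamState) :
      RamExec O (.readIn i) s
        { s.setReg i (s.input.headD 0) with input := s.input.tail }
        (1 + (s.input.headD 0).size)
  | writeOut (e : RamExpr) (s : RamState) :
      RamExec O (.writeOut e) s { s with output := s.output ++ [e.eval s] } (1 + e.cost s)
  | flip (i : ℕ) (s : RamState) :
      RamExec O (.flip i) s
        { s.setReg i (s.coins.headD false).toNat with coins := s.coins.tail } 1
  | query (i : ℕ) (s : RamState) :
      RamExec O (.query i) s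
        { s.setReg i (O s.output).toNat with output := [], queries := s.queries ++ [s.output] } 1
  | seq {p q : RamProg} {s s' s'' : RamState} {c c' : ℕ} :
      RamExec O p s s' c → RamExec O q s' s'' c' → RamExec O (.seq p q) s s'' (c + c')
  | condTrue {e : RamExpr} {p q : RamProg} {s s' : RamState} {c : ℕ} :
      e.eval s ≠ 0 → RamExec O p s s' c → RamExec O (.cond e p q) s s' (1 + e.cost s + c)
  | condFalse {e : RamExpr} {p q : RamProg} {s s' : RamState} {c : ℕ} :
      e.eval s = 0 → RamExec O q s s' c → RamExec O (.cond e p q) s s' (1 + e.cost s + c)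
  | loopTrue {e : RamExpr} {p : RamProg} {s s' s'' : RamState} {c c' : ℕ} :
      e.eval s ≠ 0 → RamExec O p s s' c → RamExec O (.loop e p) s' s'' c' →
      RamExec O (.loop e p) s s'' (1 + e.cost s + c + c')
  | loopFalse {e : RamExpr} {p : RamProg} {s : RamState} :
      e.eval s = 0 → RamExec O (.loop e p) s s (1 + e.cost s)

/-- The initial state on input word `x` with random bits `r`. -/
def RamState.init (x : List ℕ) (r : List Bool) : RamState where
  reg := fun _ => 0
  arr := fun _ _ => 0
  input := x
  output := []
  coins := r
  queries := []

/-- With oracle `O`, on input `x` and random bits `r`, the program `p` halts within cost `T` with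
the word `y` on the output tape, having asked exactly the queries `Q`. -/
def RamProg.RunsTo (p : RamProg) (O : List ℕ → Bool) (x : List ℕ) (r : List Bool) (T : ℕ)
    (y : List ℕ) (Q : List (List ℕ)) : Prop :=
  ∃ (s : RamState) (c : ℕ), RamExec O p (RamState.init x r) s c ∧ c ≤ T ∧
    s.output = y ∧ s.queries = Q

/-- The probability of the event `E` under `m` independent fair coin flips. -/
noncomputable def coinProb {m : ℕ} (E : Set (Fin m → Bool)) : ℝ :=
  (E.ncard : ℝ) / 2 ^ m

open Classical in
/-- The oracle for Exact-Edge-Weight `d`-Uniform Hyperclique. -/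
noncomputable def exactOracle (d : ℕ) (x : List ℕ) : Bool :=
  decide (∃ J : HypercliqueInstance d, J.encode = x ∧ J.ExactYes)

/-- A one-sided-error randomized polynomial-time algorithm (no oracle) that maps an `n`-vertex
instance to a family of polynomially many instances of bitsize `O(n ^ (d + 1))`, such that the
disjunction of the exact questions about them answers the maximization question. The number of
available coins equals the time bound, so the tape of coins is never exhausted. -/
def HasDisjunctiveReduction (d : ℕ) : Prop :=
  ∃ (A : RamProg) (T P : Polynomial ℕ) (C : ℕ) (c : ℝ), 0 < c ∧
    ∀ I : HypercliqueInstance d, 1 ≤ I.n →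
      ∃ F : (Fin (T.eval I.bitsize) → Bool) → List (HypercliqueInstance d),
        (∀ r, A.RunsTo (fun _ => false) I.encode (List.ofFn r) (T.eval I.bitsize)
          ((F r).flatMap HypercliqueInstance.encode) []) ∧
        (∀ r, ∀ J ∈ F r, J.bitsize ≤ C * I.n ^ (d + 1)) ∧
        (∀ r, (F r).length ≤ P.eval I.bitsize) ∧
        (I.MaxYes → ∀ r, ∃ J ∈ F r, J.ExactYes) ∧
        (¬ I.MaxYes →
          1 - (2 : ℝ) ^ (-(c * (I.n : ℝ))) ≤ coinProb {r | ∀ J ∈ F r, ¬ J.ExactYes})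

/-- A one-sided-error randomized Turing kernel of size `O(n ^ (d + 1))`: a randomized
polynomial-time oracle algorithm that decides the maximization problem and asks the oracle only
about instances of the exact problem of bitsize `O(n ^ (d + 1))`. -/
def HasRandomizedTuringKernel (d : ℕ) : Prop :=
  ∃ (B : RamProg) (T : Polynomial ℕ) (C : ℕ) (c : ℝ), 0 < c ∧
    ∀ I : HypercliqueInstance d, 1 ≤ I.n →
      ∃ (ans : (Fin (T.eval I.bitsize) → Bool) → Bool)
        (Q : (Fin (T.eval I.bitsize) → Bool) → List (HypercliqueInstance d)),
        (∀ r, B.RunsTo (exactOracle d) I.encode (List.ofFn r) (T.eval I.bitsize)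
          [(ans r).toNat] ((Q r).map HypercliqueInstance.encode)) ∧
        (∀ r, ∀ J ∈ Q r, J.bitsize ≤ C * I.n ^ (d + 1)) ∧
        (I.MaxYes → ∀ r, ans r = true) ∧
        (¬ I.MaxYes →
          1 - (2 : ℝ) ^ (-(c * (I.n : ℝ))) ≤ coinProb {r | ans r = false})

/-! ### Cost bounds for random access machines -/

/-- All numbers in the state are at most `V`, where `2 ≤ V`. -/
structure RamState.Bounded (V : ℕ) (s : RamState) : Prop where
  two_le : 2 ≤ V
  reg_le : ∀ i, s.reg i ≤ V
  arr_le : ∀ a j, s.arr a j ≤ V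

/-- In a state bounded by `V`, the value of the expression `e` is at most `V ^ e.degree`. -/
def RamExpr.degree : RamExpr → ℕ
  | const c => c + 1
  | reg _ => 1
  | cell _ _ => 1
  | add e f => e.degree + f.degree
  | sub e _ => e.degree
  | mul e f => e.degree + f.degree
  | div e _ => e.degree
  | mod e _ => e.degree

/-- In a state bounded by `V`, the expression `e` costs at most `e.weight * (V.size + 1)`. -/
def RamExpr.weight : RamExpr → ℕ
  | const c => c + 2
  | reg _ => 2
  | cell _ e => 2 + e.weight
  | add e f => e.degree + f.degree + 1 + e.weight + f.weight
  | sub e f => e.degree + 1 + e.weight + f.weight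
  | mul e f => e.degree + f.degree + 1 + e.weight + f.weight
  | div e f => e.degree + 1 + e.weight + f.weight
  | mod e f => e.degree + 1 + e.weight + f.weight

theorem RamExpr.degree_pos (e : RamExpr) : 0 < e.degree := by
  induction e <;> simp_all [RamExpr.degree]

theorem RamExpr.eval_le {V : ℕ} {s : RamState} (hs : s.Bounded V) (e : RamExpr) :
    e.eval s ≤ V ^ e.degree := by
  have h2 := hs.two_le
  have key (e : RamExpr) : 2 ≤ V ^ e.degree :=
    h2.trans (Nat.le_self_pow e.degree_pos.ne' V)
  induction e with
  | const c =>
    exact ((Nat.lt_two_pow_self).le.trans (Nat.pow_le_pow_left h2 c)).trans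
      (Nat.pow_le_pow_right (by omega) (Nat.le_succ c))
  | reg i => simpa [RamExpr.eval, RamExpr.degree] using hs.reg_le i
  | cell a e => simpa [RamExpr.eval, RamExpr.degree] using hs.arr_le a _
  | add e f he hf =>
    simp only [RamExpr.eval, RamExpr.degree, pow_add]
    -- Both powers are at least 2, so their sum is at most their product.
    have := key e
    have := key f
    nlinarith
  | sub e f he hf => exact (Nat.sub_le _ _).trans he
  | mul e f he hf =>
    simp only [RamExpr.eval, RamExpr.degree, pow_add]
    exact Nat.mul_le_mul he hf
  | div e f he hf => exact (Nat.div_le_self _ _).trans he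
  | mod e f he hf => exact (Nat.mod_le _ _).trans he

theorem Nat.size_pow_le (V : ℕ) {k : ℕ} (hk : k ≠ 0) : (V ^ k).size ≤ k * V.size := by
  rw [Nat.size_le, mul_comm, pow_mul]
  exact Nat.pow_lt_pow_left (Nat.lt_size_self V) hk

theorem RamExpr.one_add_size_eval_le {V : ℕ} {s : RamState} (hs : s.Bounded V) (e : RamExpr) :
    1 + (e.eval s).size ≤ (e.degree + 1) * (V.size + 1) := by
  have := (Nat.size_le_size (e.eval_le hs)).trans (Nat.size_pow_le V e.degree_pos.ne')
  nlinarith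

theorem RamExpr.cost_le {V : ℕ} {s : RamState} (hs : s.Bounded V) (e : RamExpr) :
    e.cost s ≤ e.weight * (V.size + 1) := by
  induction e with
  | const c => exact one_add_size_eval_le hs (.const c)
  | reg i => exact one_add_size_eval_le hs (.reg i)
  | cell a e he =>
    have := one_add_size_eval_le hs (.cell a e)
    simp only [RamExpr.cost, RamExpr.weight, RamExpr.eval, RamExpr.degree] at *
    linarith
  | add e f he hf =>
    have := one_add_size_eval_le hs (.add e f)
    simp only [RamExpr.cost, RamExpr.weight, RamExpr.eval, RamExpr.degree] at *
    linarith
  | sub e f he hf =>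
    have := one_add_size_eval_le hs (.sub e f)
    simp only [RamExpr.cost, RamExpr.weight, RamExpr.eval, RamExpr.degree] at *
    linarith
  | mul e f he hf =>
    have := one_add_size_eval_le hs (.mul e f)
    simp only [RamExpr.cost, RamExpr.weight, RamExpr.eval, RamExpr.degree] at *
    linarith
  | div e f he hf =>
    have := one_add_size_eval_le hs (.div e f)
    simp only [RamExpr.cost, RamExpr.weight, RamExpr.eval, RamExpr.degree] at *
    linarith
  | mod e f he hf =>
    have := one_add_size_eval_le hs (.mod e f)
    simp only [RamExpr.cost, RamExpr.weight, RamExpr.eval, RamExpr.degree] at *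
    linarith

/-- Bound for the cost of a program all of whose numbers have fewer than `K` bits and all of whose
loops make at most `R` rounds. -/
def RamProg.costBound (K R : ℕ) : RamProg → ℕ
  | skip => 1
  | assign _ e => 1 + e.weight * K
  | store _ e f => 1 + e.weight * K + f.weight * K
  | readIn _ => K
  | writeOut e => 1 + e.weight * K
  | flip _ => 1
  | query _ => 1
  | seq p q => p.costBound K R + q.costBound K R
  | cond e p q => 1 + e.weight * K + (p.costBound K R + q.costBound K R)
  | loop e p => (R + 1) * (1 + e.weight * K + p.costBound K R)

/-- For a fixed program, `costBound` is built from `K` and `R` by sums and products with constant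
coefficients. -/
theorem RamProg.exists_polynomial_costBound (p : RamProg) (k r : Polynomial ℕ) :
    ∃ T : Polynomial ℕ, ∀ b, T.eval b = p.costBound (k.eval b) (r.eval b) := by
  induction p with
  | skip => exact ⟨1, by simp [costBound]⟩
  | assign i e => exact ⟨1 + .C e.weight * k, by simp [costBound]⟩
  | store a e f => exact ⟨1 + .C e.weight * k + .C f.weight * k, by simp [costBound]⟩
  | readIn i => exact ⟨k, by simp [costBound]⟩
  | writeOut e => exact ⟨1 + .C e.weight * k, by simp [costBound]⟩
  | flip i => exact ⟨1, by simp [costBound]⟩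
  | query i => exact ⟨1, by simp [costBound]⟩
  | seq p q hp hq =>
    obtain ⟨P, hP⟩ := hp
    obtain ⟨Q, hQ⟩ := hq
    exact ⟨P + Q, by simp [costBound, hP, hQ]⟩
  | cond e p q hp hq =>
    obtain ⟨P, hP⟩ := hp
    obtain ⟨Q, hQ⟩ := hq
    exact ⟨1 + .C e.weight * k + (P + Q), by simp [costBound, hP, hQ]⟩
  | loop e p hp =>
    obtain ⟨P, hP⟩ := hp
    exact ⟨(r + 1) * (1 + .C e.weight * k + P), by simp [costBound, hP]⟩

/-! ### Weakest preconditions -/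

/-- Started in the state `s`, if that is bounded by `V`, the program `p` halts in a state with the
property `Q`; no number exceeds `V` and no loop makes more than `R` rounds, as far as this matters
for the cost. -/
def RamProg.Wp (O : List ℕ → Bool) (V R : ℕ) (p : RamProg) (s : RamState)
    (Q : RamState → Prop) : Prop :=
  s.Bounded V → ∃ s' c, RamExec O p s s' c ∧ c ≤ p.costBound (V.size + 1) R ∧ s'.Bounded V ∧ Q s'

/-! ### Effect of updates on the components of a state. -/

@[simp] theorem RamState.setReg_reg (s : RamState) (i v j : ℕ) :
    (s.setReg i v).reg j = if j = i then v else s.reg j := by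
  simp [RamState.setReg, Function.update_apply]

@[simp] theorem RamState.setReg_arr (s : RamState) (i v : ℕ) : (s.setReg i v).arr = s.arr := rfl

@[simp] theorem RamState.setReg_input (s : RamState) (i v : ℕ) :
    (s.setReg i v).input = s.input := rfl

@[simp] theorem RamState.setReg_output (s : RamState) (i v : ℕ) :
    (s.setReg i v).output = s.output := rfl

@[simp] theorem RamState.setReg_coins (s : RamState) (i v : ℕ) :
    (s.setReg i v).coins = s.coins := rfl

@[simp] theorem RamState.setReg_queries (s : RamState) (i v : ℕ) :
    (s.setReg i v).queries = s.queries := rfl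

@[simp] theorem RamState.setCell_arr (s : RamState) (a j v b k : ℕ) :
    (s.setCell a j v).arr b k = if b = a ∧ k = j then v else s.arr b k := by
  simp only [RamState.setCell, Function.update_apply]
  split_ifs <;> simp_all

@[simp] theorem RamState.setCell_reg (s : RamState) (a j v : ℕ) :
    (s.setCell a j v).reg = s.reg := rfl

@[simp] theorem RamState.setCell_input (s : RamState) (a j v : ℕ) :
    (s.setCell a j v).input = s.input := rfl

@[simp] theorem RamState.setCell_output (s : RamState) (a j v : ℕ) :
    (s.setCell a j v).output = s.output := rfl

@[simp] theorem RamState.setCell_coins (s : RamState) (a j v : ℕ) :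
    (s.setCell a j v).coins = s.coins := rfl

@[simp] theorem RamState.setCell_queries (s : RamState) (a j v : ℕ) :
    (s.setCell a j v).queries = s.queries := rfl

theorem RamState.Bounded.setReg {V : ℕ} {s : RamState} (hs : s.Bounded V) {i v : ℕ} (hv : v ≤ V) :
    (s.setReg i v).Bounded V := by
  refine ⟨hs.two_le, fun j => ?_, hs.arr_le⟩
  rw [RamState.setReg_reg]
  split_ifs
  exacts [hv, hs.reg_le j]

theorem RamState.Bounded.setCell {V : ℕ} {s : RamState} (hs : s.Bounded V) {a j v : ℕ}
    (hv : v ≤ V) : (s.setCell a j v).Bounded V := by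
  refine ⟨hs.two_le, hs.reg_le, fun b k => ?_⟩
  rw [RamState.setCell_arr]
  split_ifs
  exacts [hv, hs.arr_le b k]

namespace RamProg

variable {O : List ℕ → Bool} {V R : ℕ} {s : RamState} {Q Q' : RamState → Prop}

theorem Wp.mono {p : RamProg} (h : p.Wp O V R s Q) (hQ : ∀ s', Q s' → Q' s') :
    p.Wp O V R s Q' := fun hs =>
  let ⟨s', c, h₁, h₂, h₃, h₄⟩ := h hs
  ⟨s', c, h₁, h₂, h₃, hQ s' h₄⟩

theorem wp_skip (h : Q s) : skip.Wp O V R s Q := fun hs =>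
  ⟨s, 1, .skip s, le_rfl, hs, h⟩

theorem wp_assign {i : ℕ} {e : RamExpr} (hv : e.eval s ≤ V) (h : Q (s.setReg i (e.eval s))) :
    (assign i e).Wp O V R s Q := fun hs =>
  ⟨_, _, .assign i e s, Nat.add_le_add_left (e.cost_le hs) 1, hs.setReg hv, h⟩

theorem wp_store {a : ℕ} {e f : RamExpr} (hv : f.eval s ≤ V)
    (h : Q (s.setCell a (e.eval s) (f.eval s))) : (store a e f).Wp O V R s Q := fun hs =>
  ⟨_, _, .store a e f s,
    Nat.add_le_add (Nat.add_le_add_left (e.cost_le hs) 1) (f.cost_le hs), hs.setCell hv, h⟩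

theorem wp_readIn {i : ℕ} (hv : s.input.headD 0 ≤ V)
    (h : Q { s.setReg i (s.input.headD 0) with input := s.input.tail }) :
    (readIn i).Wp O V R s Q := fun hs =>
  have hb := hs.setReg (i := i) hv
  ⟨_, _, .readIn i s, by
    have := Nat.size_le_size hv
    simp only [costBound]
    omega, ⟨hb.two_le, hb.reg_le, hb.arr_le⟩, h⟩

theorem wp_writeOut {e : RamExpr} (h : Q { s with output := s.output ++ [e.eval s] }) :
    (writeOut e).Wp O V R s Q := fun hs =>
  ⟨_, _, .writeOut e s, Nat.add_le_add_left (e.cost_le hs) 1,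
    ⟨hs.two_le, hs.reg_le, hs.arr_le⟩, h⟩

theorem wp_flip {i : ℕ}
    (h : Q { s.setReg i (s.coins.headD false).toNat with coins := s.coins.tail }) :
    (flip i).Wp O V R s Q := fun hs =>
  have hb := hs.setReg (i := i) (v := (s.coins.headD false).toNat)
    ((Bool.toNat_le _).trans ((by norm_num : 1 ≤ 2).trans hs.two_le))
  ⟨_, _, .flip i s, le_rfl, ⟨hb.two_le, hb.reg_le, hb.arr_le⟩, h⟩

theorem wp_query {i : ℕ}
    (h : Q { s.setReg i (O s.output).toNat with
      output := [], queries := s.queries ++ [s.output] }) :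
    (query i).Wp O V R s Q := fun hs =>
  have hb := hs.setReg (i := i) (v := (O s.output).toNat)
    ((Bool.toNat_le _).trans ((by norm_num : 1 ≤ 2).trans hs.two_le))
  ⟨_, _, .query i s, le_rfl, ⟨hb.two_le, hb.reg_le, hb.arr_le⟩, h⟩

theorem wp_seq {p q : RamProg} (h : p.Wp O V R s fun s' => q.Wp O V R s' Q) :
    (seq p q).Wp O V R s Q := fun hs =>
  let ⟨_, _, h₁, h₂, h₃, h₄⟩ := h hs
  let ⟨s'', _, h₅, h₆, h₇, h₈⟩ := h₄ h₃
  ⟨s'', _, .seq h₁ h₅, Nat.add_le_add h₂ h₆, h₇, h₈⟩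

theorem wp_cond {e : RamExpr} {p q : RamProg} (h₁ : e.eval s ≠ 0 → p.Wp O V R s Q)
    (h₀ : e.eval s = 0 → q.Wp O V R s Q) : (cond e p q).Wp O V R s Q := fun hs => by
  have hc := e.cost_le hs
  by_cases he : e.eval s = 0
  · obtain ⟨s', c, h₂, h₃, h₄⟩ := h₀ he hs
    exact ⟨s', _, .condFalse he h₂, by simp only [costBound]; omega, h₄⟩
  · obtain ⟨s', c, h₂, h₃, h₄⟩ := h₁ he hs
    exact ⟨s', _, .condTrue he h₂, by simp only [costBound]; omega, h₄⟩

/-- The invariant is indexed by completed rounds and decides the loop test, so the loop makes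
exactly `m` rounds; the induction is on the number `j` of rounds that remain. -/
theorem wp_loop {e : RamExpr} {p : RamProg} (Inv : ℕ → RamState → Prop) (m : ℕ) (hm : m ≤ R)
    (h₀ : Inv 0 s)
    (hstep : ∀ k < m, ∀ s, Inv k s → e.eval s ≠ 0 ∧ p.Wp O V R s (Inv (k + 1)))
    (hend : ∀ s, Inv m s → e.eval s = 0 ∧ Q s) : (loop e p).Wp O V R s Q := by
  intro hs
  suffices H : ∀ j ≤ m, ∀ s, Inv (m - j) s → s.Bounded V →
      ∃ s' c, RamExec O (loop e p) s s' c ∧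
        c ≤ (j + 1) * (1 + e.weight * (V.size + 1) + p.costBound (V.size + 1) R) ∧
        s'.Bounded V ∧ Q s' by
    obtain ⟨s', c, h₁, h₂, h₃⟩ := H m le_rfl s (by simpa using h₀) hs
    refine ⟨s', c, h₁, h₂.trans ?_, h₃⟩
    simp only [costBound]
    gcongr
  intro j
  induction j with
  | zero =>
    intro _ s hI hs
    obtain ⟨he, hQ⟩ := hend s (by simpa using hI)
    have := e.cost_le hs
    exact ⟨s, _, .loopFalse he, by omega, hs, hQ⟩
  | succ j ih =>
    intro hj s hI hs
    obtain ⟨he, hp⟩ := hstep _ (by omega) s hI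
    obtain ⟨s₁, c₁, h₁, h₂, h₃, h₄⟩ := hp hs
    rw [show m - (j + 1) + 1 = m - j by omega] at h₄
    obtain ⟨s₂, c₂, h₅, h₆, h₇⟩ := ih (by omega) s₁ h₄ h₃
    have := e.cost_le hs
    exact ⟨s₂, _, .loopTrue he h₁ h₅, by rw [add_mul]; omega, h₇⟩

/-- Run `p` with the register `c` counting from zero up to the value of `e`. -/
def forUp (c : ℕ) (e : RamExpr) (p : RamProg) : RamProg :=
  seq (assign c (.const 0))
    (loop (.sub e (.reg c)) (seq p (assign c (.add (.reg c) (.const 1)))))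

/-- The limit `e` is evaluated anew in every round, so the invariant has to fix its value; the body
has to leave the counter alone. -/
theorem wp_forUp {c : ℕ} {e : RamExpr} {p : RamProg} (Inv : ℕ → RamState → Prop) (m : ℕ)
    (hm : m ≤ R) (hV : m ≤ V) (h₀ : Inv 0 (s.setReg c 0))
    (he : ∀ k s, Inv k s → e.eval s = m)
    (hstep : ∀ k < m, ∀ s, Inv k s → s.reg c = k →
      p.Wp O V R s fun s' => s'.reg c = k ∧ Inv (k + 1) (s'.setReg c (k + 1)))
    (hend : ∀ s, Inv m s → Q s) : (forUp c e p).Wp O V R s Q := by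
  refine wp_seq (wp_assign (Nat.zero_le _) ?_)
  refine wp_loop (fun k s => s.reg c = k ∧ Inv k s) m hm ⟨by simp [RamExpr.eval], h₀⟩ ?_ ?_
  · rintro k hk s ⟨hc, hI⟩
    refine ⟨by simp only [RamExpr.eval, he k s hI, hc]; omega, wp_seq ?_⟩
    refine (hstep k hk s hI hc).mono ?_
    rintro s' ⟨hc', hI'⟩
    refine wp_assign (by simp only [RamExpr.eval, hc']; omega) ?_
    simpa [RamExpr.eval, hc'] using hI'
  · rintro s ⟨hc, hI⟩
    exact ⟨by simp only [RamExpr.eval, he m s hI, hc]; omega, hend s hI⟩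

end RamProg

/-! ### From a threshold to few exact values -/

section Threshold

variable {ι : Type*} (s : Finset ι) (w : ι → ℕ)

/-- `⌈t / P⌉`. -/
def divUp (t P : ℕ) : ℕ := (t + P - 1) / P

theorem le_mul_divUp (t : ℕ) {P : ℕ} (hP : 0 < P) : t ≤ P * divUp t P := by
  have := Nat.lt_mul_div_succ (t + P - 1) hP
  rw [mul_add, mul_one] at this
  unfold divUp
  omega

theorem divUp_pos {t P : ℕ} (ht : 0 < t) (hP : 0 < P) : 0 < divUp t P :=
  Nat.div_pos (by omega) hP

theorem divUp_le {t P : ℕ} (hP : 0 < P) : divUp t P ≤ t := by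
  rcases Nat.eq_zero_or_pos t with rfl | ht
  · simp [divUp, Nat.div_eq_of_lt (Nat.sub_lt hP one_pos)]
  · refine Nat.div_le_of_le_mul ?_
    obtain ⟨t, rfl⟩ : ∃ u, t = u + 1 := ⟨t - 1, by omega⟩
    obtain ⟨P, rfl⟩ : ∃ u, P = u + 1 := ⟨P - 1, by omega⟩
    have : t + 1 + (P + 1) - 1 = t + P + 1 := by omega
    rw [this]
    nlinarith [Nat.zero_le (t * P)]

theorem divUp_two_mul_le (t : ℕ) {P : ℕ} (hP : 0 < P) : 2 * divUp t (P * 2) ≤ divUp t P + 1 := by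
  -- With this form of the right side, `divUp t (P * 2)` is its half rounded down.
  have h : divUp t P + 1 = (t + P * 2 - 1) / P := by
    rw [divUp, ← Nat.add_div_right _ hP]
    congr 1
    omega
  rw [h, divUp, ← Nat.div_div_eq_div_mul]
  omega

theorem sum_div_lt_divUp {t P : ℕ} (hP : 0 < P) (h : ∑ e ∈ s, w e < t) :
    ∑ e ∈ s, w e / P < divUp t P := by
  have h₁ : P * ∑ e ∈ s, w e / P ≤ ∑ e ∈ s, w e := by
    rw [Finset.mul_sum]
    exact Finset.sum_le_sum fun e _ => Nat.mul_div_le _ _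
  exact Nat.lt_of_mul_lt_mul_left ((h₁.trans_lt h).trans_le (le_mul_divUp t hP))

/-- Take the level `k` just before the first one at which the rounded sum misses the rounded
threshold. Going from `k` to `k + 1` loses at most 1 per summand after doubling, and the thresholds
at least nearly double back, so the excess at `k` is at most `N`. -/
theorem exists_sum_div_eq_divUp_add {t N U : ℕ} (ht : 0 < t) (hN : s.card ≤ N)
    (h : t ≤ ∑ e ∈ s, w e) (hU : ∑ e ∈ s, w e ≤ U) :
    ∃ k < U.size, ∃ j ≤ N, ∑ e ∈ s, w e / 2 ^ k = divUp t (2 ^ k) + j := by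
  have hex : ∃ k, ∑ e ∈ s, w e / 2 ^ k < divUp t (2 ^ k) := by
    refine ⟨U.size, ?_⟩
    rw [Finset.sum_eq_zero fun e he => Nat.div_eq_of_lt
      (((Finset.single_le_sum (fun _ _ => Nat.zero_le _) he).trans hU).trans_lt
        (Nat.lt_size_self U))]
    exact divUp_pos ht (by positivity)
  classical
  obtain ⟨k, hk⟩ : ∃ k, Nat.find hex = k + 1 := by
    refine Nat.exists_eq_succ_of_ne_zero fun h₀ => ?_
    have := Nat.find_spec hex
    rw [h₀] at this
    simp only [pow_zero, Nat.div_one, divUp] at this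
    omega
  have h₁ : divUp t (2 ^ k) ≤ ∑ e ∈ s, w e / 2 ^ k :=
    not_lt.1 (Nat.find_min hex (by omega))
  have h₂ : ∑ e ∈ s, w e / 2 ^ (k + 1) < divUp t (2 ^ (k + 1)) := hk ▸ Nat.find_spec hex
  have h₃ : ∑ e ∈ s, w e / 2 ^ k ≤ 2 * ∑ e ∈ s, w e / 2 ^ (k + 1) + N := by
    calc ∑ e ∈ s, w e / 2 ^ k ≤ ∑ e ∈ s, (2 * (w e / 2 ^ (k + 1)) + 1) := by
          refine Finset.sum_le_sum fun e _ => ?_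
          rw [pow_succ, ← Nat.div_div_eq_div_mul]
          omega
      _ ≤ _ := by
          rw [Finset.sum_add_distrib, ← Finset.mul_sum, Finset.sum_const, smul_eq_mul, mul_one]
          omega
  have h₄ := divUp_two_mul_le t (P := 2 ^ k) (by positivity)
  rw [← pow_succ] at h₄
  refine ⟨k, ?_, ∑ e ∈ s, w e / 2 ^ k - divUp t (2 ^ k), by omega, by omega⟩
  -- From level `U.size` on all rounded weights vanish, while the rounded threshold stays positive.
  by_contra! hle
  have : ∑ e ∈ s, w e / 2 ^ k = 0 := Finset.sum_eq_zero fun e he => Nat.div_eq_of_lt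
    (((Finset.single_le_sum (fun _ _ => Nat.zero_le _) he).trans hU).trans_lt
      ((Nat.lt_size_self U).trans_le (Nat.pow_le_pow_right two_pos hle)))
  have := divUp_pos ht (P := 2 ^ k) (by positivity)
  omega

/-! ### Multiply-shift hashing -/

/-- The multiply-shift hash function: the leading part of `a * x` modulo `H`, as a number below
`Q`. -/
def mulShift (a H Q x : ℕ) : ℕ := a * x % H * Q / H

theorem mulShift_lt {H Q : ℕ} (a x : ℕ) (hH : 0 < H) (hQ : 0 < Q) : mulShift a H Q x < Q := by
  rw [mulShift, Nat.div_lt_iff_lt_mul hH, mul_comm Q]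
  exact Nat.mul_lt_mul_of_pos_right (Nat.mod_lt _ hH) hQ

/-- Multiply-shift hashing is additive up to multiples of `Q` and a rounding error. -/
theorem exists_sum_mulShift_add_one {a H Q : ℕ} (hH : 0 < H) (x : ι → ℕ) :
    ∃ i ≤ s.card, ∃ o ≤ s.card, ∑ e ∈ s, (mulShift a H Q (x e) + 1) =
      mulShift a H Q (∑ e ∈ s, x e) + i * Q + o ∧ (0 < s.card → 0 < o) := by
  rcases s.eq_empty_or_nonempty with rfl | hs
  · exact ⟨0, le_rfl, 0, le_rfl, by simp [mulShift]⟩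
  set Y := ∑ e ∈ s, a * x e % H with hY
  have hmod : Y % H = a * (∑ e ∈ s, x e) % H := by
    rw [Finset.mul_sum, Finset.sum_nat_mod s H fun e => a * x e]
  have hYle : Y ≤ s.card * H := by
    rw [← smul_eq_mul]
    exact Finset.sum_le_card_nsmul _ _ _ fun e _ => (Nat.mod_lt _ hH).le
  have hA : Y * Q / H = mulShift a H Q (∑ e ∈ s, x e) + Y / H * Q := by
    conv_lhs => rw [← Nat.mod_add_div Y H, hmod]
    rw [add_mul, mul_assoc, Nat.add_mul_div_left _ _ hH, mulShift]
  set F := ∑ e ∈ s, mulShift a H Q (x e) with hF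
  have h₁ : F ≤ Y * Q / H := by
    rw [Nat.le_div_iff_mul_le hH, hF, hY, Finset.sum_mul, Finset.sum_mul]
    exact Finset.sum_le_sum fun e _ => Nat.div_mul_le_self _ _
  have h₂ : Y * Q / H < F + s.card := by
    rw [Nat.div_lt_iff_lt_mul hH, add_mul, hF, hY, Finset.sum_mul, Finset.sum_mul,
      ← smul_eq_mul s.card, ← Finset.sum_const, ← Finset.sum_add_distrib]
    refine Finset.sum_lt_sum_of_nonempty hs fun e _ => ?_
    exact (Nat.lt_div_mul_add hH)
  -- `Y / H` counts the wraps. The floors lose less than `s.card` in total, so the extra 1 per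
  -- summand turns the loss into an offset between 1 and `s.card`.
  refine ⟨Y / H, Nat.div_le_of_le_mul (by rwa [mul_comm]), F + s.card - Y * Q / H, by omega, ?_,
    by omega⟩
  rw [Finset.sum_add_distrib, Finset.sum_const, smul_eq_mul, mul_one, ← hF]
  omega

end Threshold

/-- The residue of `a * D` modulo `H` is close to zero. -/
def NearMultiple (H Q B D : ℕ) (a : ℤ) : Prop :=
  ∃ z : ℤ, |a * D - z * H| * Q < B * H

/-- Only the residue of the multiplier counts. This allows the multiplier made from the coins
actually used to be replaced by one made from the whole tape. -/
theorem NearMultiple.of_modEq {H Q B D : ℕ} {a b : ℤ} (h : NearMultiple H Q B D a)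
    (hab : a ≡ b [ZMOD H]) : NearMultiple H Q B D b := by
  obtain ⟨z, hz⟩ := h
  obtain ⟨c, hc⟩ := hab.dvd
  refine ⟨z + c * D, ?_⟩
  have : b * D - (z + c * D) * H = a * D - z * H := by
    rw [show b = a + H * c by linarith]
    ring
  rwa [this]

/-- Undo the floors: `H` times a hash value is `(a * X % H) * Q` up to a remainder below `H`. The
offsets differ by at most `B - 1`, and the difference of the remainders adds less than one further
`H`. -/
theorem nearMultiple_of_mulShift_eq {a H Q X Y i i' o o' B : ℕ} (hH : 0 < H)
    (h : mulShift a H Q X + i * Q + o = mulShift a H Q Y + i' * Q + o') (ho : o < B) (ho' : o' < B)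
    (hXY : Y ≤ X) : NearMultiple H Q B (X - Y) a := by
  have hX := Nat.div_add_mod (a * X % H * Q) H
  have hY := Nat.div_add_mod (a * Y % H * Q) H
  have hX' := Nat.div_add_mod (a * X) H
  have hY' := Nat.div_add_mod (a * Y) H
  have hrX := Nat.mod_lt (a * X % H * Q) hH
  have hrY := Nat.mod_lt (a * Y % H * Q) hH
  unfold mulShift at h
  generalize a * X % H * Q / H = hx at *
  generalize a * Y % H * Q / H = hy at *
  generalize a * X % H * Q % H = rx at *
  generalize a * Y % H * Q % H = ry at *
  generalize a * X / H = qx at *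
  generalize a * Y / H = qy at *
  generalize a * X % H = mx at *
  generalize a * Y % H = my at *
  zify at *
  -- The quotients of `a * X` and `a * Y` by `H`, corrected by the wraps on the two sides.
  refine ⟨qx - qy + (i' - i), ?_⟩
  rw [Nat.cast_sub (by exact_mod_cast hXY)]
  have key : ((a : ℤ) * (X - Y) - (qx - qy + (i' - i)) * H) * Q = H * (o' - o) + (rx - ry) := by
    have e1 : (a : ℤ) * (X - Y) = H * qx + mx - (H * qy + my) := by rw [hX', hY']; ring
    rw [e1]
    have e2 : (hx : ℤ) = hy + i' * Q + o' - i * Q - o := by linarith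
    rw [e2] at hX
    linear_combination -hX + hY
  rw [← Nat.abs_cast Q, ← abs_mul, key, abs_lt]
  have hHi : (0 : ℤ) < H := by exact_mod_cast hH
  have h1 : (o' : ℤ) + 1 ≤ B := ho'
  have h2 : (o : ℤ) + 1 ≤ B := ho
  constructor <;> nlinarith [Int.natCast_nonneg o, Int.natCast_nonneg o', Int.natCast_nonneg rx,
    Int.natCast_nonneg ry]

open Classical in
/-- Few odd multipliers below `2 ^ (m + 1)` bring a given nonzero residue close to zero. -/
theorem card_nearMultiple_le {m T Q B D : ℕ} (hmT : m ≤ T) (hQ : 0 < Q) (hD : 0 < D)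
    (hDm : D < 2 ^ (m + 1)) :
    Q * ((Finset.range (2 ^ T)).filter fun X : ℕ =>
      NearMultiple (2 ^ (m + 1)) Q B D (1 + 2 * X)).card ≤ 4 * B * 2 ^ T := by
  -- The factor `2 ^ v` cancels against the modulus and leaves an odd `D'` modulo `2 ^ (M + 1)`,
  -- which is invertible.
  obtain ⟨v, D', hodd, rfl⟩ := Nat.exists_eq_two_pow_mul_odd hD.ne'
  have hv : v < m + 1 := by
    refine (Nat.pow_lt_pow_iff_right one_lt_two).1 (lt_of_le_of_lt ?_ hDm)
    exact Nat.le_mul_of_pos_right _ hodd.pos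
  obtain ⟨M, rfl⟩ : ∃ M, m = v + M := ⟨m - v, by omega⟩
  have hpow : ((2 ^ (v + M + 1) : ℕ) : ℤ) = 2 ^ v * 2 ^ (M + 1) := by
    push_cast
    ring
  set K := B * 2 ^ (M + 1) / Q with hK
  have hnear : ∀ X : ℕ, NearMultiple (2 ^ (v + M + 1)) Q B (2 ^ v * D') (1 + 2 * X) →
      ∃ z : ℤ, |(1 + 2 * X) * (D' : ℤ) - z * 2 ^ (M + 1)| ≤ K := by
    rintro X ⟨z, hz⟩
    refine ⟨z, ?_⟩
    rw [hpow] at hz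
    have h₁ : (1 + 2 * (X : ℤ)) * ((2 ^ v * D' : ℕ) : ℤ) - z * (2 ^ v * 2 ^ (M + 1)) =
        2 ^ v * ((1 + 2 * X) * (D' : ℤ) - z * 2 ^ (M + 1)) := by
      push_cast
      ring
    rw [h₁, abs_mul, abs_of_pos (by positivity : (0 : ℤ) < 2 ^ v)] at hz
    have h₂ : |(1 + 2 * (X : ℤ)) * (D' : ℤ) - z * 2 ^ (M + 1)| * Q < B * 2 ^ (M + 1) := by
      refine lt_of_mul_lt_mul_left (a := (2 : ℤ) ^ v) ?_ (by positivity)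
      linarith
    rw [hK]
    push_cast
    rw [Int.le_ediv_iff_mul_le (by exact_mod_cast hQ)]
    exact h₂.le
  choose! z hz using hnear
  -- The signed remainder determines `X` modulo `2 ^ M`, and `X / 2 ^ M` supplies the remaining
  -- digits. The remainder is odd, hence never 0; excluding 0 leaves `2 * K` values rather than `2 *
  -- K + 1`, without which the bound would fail for small `K`.
  have hcard : ((Finset.range (2 ^ T)).filter fun X : ℕ =>
      NearMultiple (2 ^ (v + M + 1)) Q B (2 ^ v * D') (1 + 2 * X)).card ≤
      (((Finset.Icc (-(K : ℤ)) K).erase 0) ×ˢ Finset.range (2 ^ (T - M))).card := by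
    refine Finset.card_le_card_of_injOn
      (fun X => ((1 + 2 * X) * (D' : ℤ) - z X * 2 ^ (M + 1), X / 2 ^ M)) ?_ ?_
    · intro X hX
      simp only [Finset.coe_filter, Finset.mem_range, Set.mem_ofPred_eq] at hX
      simp only [Finset.coe_product, Set.mem_prod, Finset.mem_coe, Finset.mem_erase,
        Finset.mem_Icc, Finset.mem_range]
      refine ⟨⟨fun h₀ => ?_, abs_le.1 (hz X hX.2)⟩, ?_⟩
      · obtain ⟨c, hc⟩ := hodd
        rw [pow_succ, hc] at h₀
        push_cast at h₀
        have : (1 + 2 * (X : ℤ)) * (2 * c + 1) - z X * (2 ^ M * 2) =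
          2 * (c + 2 * X * c + X - z X * 2 ^ M) + 1 := by ring
        omega
      · rw [Nat.div_lt_iff_lt_mul (by positivity), ← pow_add, Nat.sub_add_cancel (by omega)]
        exact hX.1
    · intro X _ X' _ h
      simp only [Prod.mk.injEq] at h
      obtain ⟨h₁, h₂⟩ := h
      have hdvd : (2 ^ (M + 1) : ℤ) ∣ (2 * ((X : ℤ) - X')) * D' :=
        ⟨z X - z X', by linear_combination h₁⟩
      have hcop : IsCoprime (2 ^ (M + 1) : ℤ) (D' : ℤ) := by
        have : Nat.Coprime (2 ^ (M + 1)) D' := (Nat.coprime_two_left.2 hodd).pow_left _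
        have := Nat.isCoprime_iff_coprime.2 this
        push_cast at this
        exact this
      have hdvd := hcop.dvd_of_dvd_mul_right hdvd
      rw [pow_succ, mul_comm] at hdvd
      have hdvd := Int.dvd_of_mul_dvd_mul_left two_ne_zero hdvd
      have hmod : X ≡ X' [MOD 2 ^ M] := by
        rw [← Int.natCast_modEq_iff]
        push_cast
        exact (Int.modEq_iff_dvd.2 hdvd).symm
      rw [← Nat.div_add_mod X (2 ^ M), ← Nat.div_add_mod X' (2 ^ M), h₂, hmod]
  have hKc : ((Finset.Icc (-(K : ℤ)) K).erase 0).card = 2 * K := by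
    rw [Finset.card_erase_of_mem (by simp), Int.card_Icc]
    omega
  rw [Finset.card_product, hKc, Finset.card_range] at hcard
  calc _ ≤ Q * (2 * K * 2 ^ (T - M)) := Nat.mul_le_mul_left _ hcard
    _ = 2 * (Q * K) * 2 ^ (T - M) := by ring
    _ ≤ 2 * (B * 2 ^ (M + 1)) * 2 ^ (T - M) := by
        exact Nat.mul_le_mul_right _ (Nat.mul_le_mul_left _ (Nat.mul_div_le _ _))
    _ = 4 * B * (2 ^ M * 2 ^ (T - M)) := by ring
    _ = 4 * B * 2 ^ T := by rw [← pow_add, Nat.add_sub_cancel' (by omega)]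

/-! ### Coins -/

/-- The number whose binary digits, from the least significant one, are the given coins. -/
def coinValue (l : List Bool) : ℕ := Nat.ofDigits 2 (l.map Bool.toNat)

theorem coinValue_nil : coinValue [] = 0 := rfl

theorem coinValue_append (l l' : List Bool) :
    coinValue (l ++ l') = coinValue l + 2 ^ l.length * coinValue l' := by
  simp [coinValue, Nat.ofDigits_append]

theorem coinValue_lt (l : List Bool) : coinValue l < 2 ^ l.length := by
  have := Nat.ofDigits_lt_base_pow_length (b := 2) (l := l.map Bool.toNat) one_lt_two (by
    simp only [List.mem_map]
    rintro _ ⟨b, -, rfl⟩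
    exact b.toNat_lt)
  simpa [coinValue] using this

theorem coinValue_injOn {l l' : List Bool} (hl : l.length = l'.length)
    (h : coinValue l = coinValue l') : l = l' := by
  have hd (l : List Bool) : ∀ x ∈ l.map Bool.toNat, x < 2 := by
    simp only [List.mem_map]
    rintro _ ⟨b, -, rfl⟩
    exact b.toNat_lt
  have := Nat.ofDigits_inj_of_len_eq one_lt_two (by simpa using hl) (hd l) (hd l') h
  exact List.map_injective_iff.2 (fun a b => by cases a <;> cases b <;> simp) this

/-- Coins from position `m` on contribute multiples of `2 ^ (m + 1)` to the multiplier. -/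
theorem coinValue_take_modEq (l : List Bool) {m : ℕ} (hm : m ≤ l.length) :
    ((1 + 2 * coinValue (l.take m) : ℕ) : ℤ) ≡ 1 + 2 * coinValue l [ZMOD (2 ^ (m + 1) : ℕ)] := by
  have : 1 + 2 * coinValue l =
      1 + 2 * coinValue (l.take m) + 2 ^ (m + 1) * coinValue (l.drop m) := by
    conv_lhs => rw [← List.take_append_drop m l, coinValue_append, List.length_take,
      min_eq_left hm]
    ring
  rw [show (1 + 2 * coinValue l : ℤ) = ((1 + 2 * coinValue l : ℕ) : ℤ) by push_cast; rfl, this,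
    Int.natCast_modEq_iff]
  exact (Nat.modEq_iff_dvd' (by omega)).2 (by simp)

/-- Union bound: tapes inject into the numbers below `2 ^ T`, each `D` spoils at most a fraction `4
* B / Q` of these, and `hcard` brings the total down to `2 ^ (-n)`. -/
theorem le_coinProb_of_forall_nearMultiple {T m Q B n : ℕ} (hmT : m ≤ T) (hQ : 0 < Q)
    (𝒟 : Finset ℕ) (h𝒟 : ∀ D ∈ 𝒟, 0 < D ∧ D < 2 ^ (m + 1))
    (hcard : 𝒟.card * (4 * B) * 2 ^ n ≤ Q) (E : Set (Fin T → Bool))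
    (hE : ∀ r ∉ E, ∃ D ∈ 𝒟,
      NearMultiple (2 ^ (m + 1)) Q B D (1 + 2 * coinValue (List.ofFn r))) :
    1 - (2 : ℝ) ^ (-(1 * (n : ℝ))) ≤ coinProb E := by
  classical
  have h₁ : Eᶜ.ncard ≤ (𝒟.biUnion fun D => (Finset.range (2 ^ T)).filter fun X : ℕ =>
      NearMultiple (2 ^ (m + 1)) Q B D (1 + 2 * X)).card := by
    rw [← Set.ncard_coe_finset]
    refine Set.ncard_le_ncard_of_injOn (fun r => coinValue (List.ofFn r)) ?_ ?_ (Finset.finite_toSet _)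
    · intro r hr
      obtain ⟨D, hD, hnear⟩ := hE r hr
      simp only [Finset.coe_biUnion, Set.mem_iUnion, Finset.mem_coe, Finset.mem_filter,
        Finset.mem_range]
      refine ⟨D, hD, ?_, hnear⟩
      simpa using coinValue_lt (List.ofFn r)
    · intro r _ r' _ h
      exact List.ofFn_injective (coinValue_injOn (by simp) h)
  have h₂ : Q * Eᶜ.ncard ≤ 𝒟.card * (4 * B * 2 ^ T) := by
    refine (Nat.mul_le_mul_left Q (h₁.trans Finset.card_biUnion_le)).trans ?_
    rw [Finset.mul_sum, ← smul_eq_mul, ← Finset.sum_const]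
    exact Finset.sum_le_sum fun D hD =>
      card_nearMultiple_le hmT hQ (h𝒟 D hD).1 (h𝒟 D hD).2
  have h₃ : Eᶜ.ncard * 2 ^ n ≤ 2 ^ T := by
    refine Nat.le_of_mul_le_mul_left ?_ hQ
    calc Q * (Eᶜ.ncard * 2 ^ n) = Q * Eᶜ.ncard * 2 ^ n := by ring
      _ ≤ 𝒟.card * (4 * B * 2 ^ T) * 2 ^ n := by gcongr
      _ = 𝒟.card * (4 * B) * 2 ^ n * 2 ^ T := by ring
      _ ≤ Q * 2 ^ T := by gcongr
  have h₄ : E.ncard + Eᶜ.ncard = 2 ^ T := by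
    rw [Set.ncard_add_ncard_compl]
    simp
  rw [coinProb, one_mul, Real.rpow_neg two_pos.le, Real.rpow_natCast]
  rify at h₃ h₄
  rw [le_div_iff₀ (by positivity), ← h₄, sub_mul, one_mul, sub_le_iff_le_add]
  have h₅ : (Eᶜ.ncard : ℝ) ≤ (2 ^ n)⁻¹ * 2 ^ T := by
    rw [inv_mul_eq_div, le_div_iff₀ (by positivity)]
    exact h₃
  rw [← h₄] at h₅
  linarith

/-! ### Expressions -/

namespace RamExpr

/-- The product of the expressions `f 0, …, f (k - 1)`. -/
def prodRange (f : ℕ → RamExpr) : ℕ → RamExpr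
  | 0 => const 1
  | k + 1 => mul (prodRange f k) (f k)

/-- One if the value of the expression is nonzero, and zero otherwise. -/
def flag (e : RamExpr) : RamExpr := sub (const 1) (sub (const 1) e)

theorem eval_prodRange (s : RamState) (f : ℕ → RamExpr) (k : ℕ) :
    (prodRange f k).eval s = ∏ i ∈ Finset.range k, (f i).eval s := by
  induction k with
  | zero => rfl
  | succ k ih => rw [prodRange, eval, ih, Finset.prod_range_succ]

theorem eval_flag (s : RamState) (e : RamExpr) :
    (flag e).eval s = if e.eval s = 0 then 0 else 1 := by
  simp only [flag, eval]
  split_ifs <;> omega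

end RamExpr

/-! ### The program -/

namespace HypercliqueProg

open RamExpr RamProg

/-- Read the instance: `n`, `t`, `n ^ d` go to the registers 0, 1, 2, the tensor goes to the array
0, and a number exceeding everything of interest goes to the register 3. -/
def readProg (d : ℕ) : RamProg :=
  seq (readIn 0) <| seq (readIn 1) <| seq (assign 2 (prodRange (fun _ => reg 0) d)) <|
  seq (assign 3 (.add (.add (reg 1) (reg 2)) (const 1))) <|
  forUp 8 (reg 2) <| seq (readIn 15) <| seq (store 0 (reg 8) (reg 15)) <|
    assign 3 (.add (reg 3) (reg 15))

/-- Put the powers of two up to `2 ^ n` into the array 1 and the register 7. -/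
def powersProg : RamProg :=
  seq (assign 7 (const 1)) <|
  forUp 8 (reg 0) <| seq (store 1 (reg 8) (reg 7)) <| assign 7 (mul (const 2) (reg 7))

/-- Put the least power of two exceeding the register 3 into the register 4, and a random odd
number below it into the register 5; the register 6 counts the coins that were used. -/
def randomProg : RamProg :=
  seq (assign 4 (const 2)) <| seq (assign 5 (const 1)) <|
  loop (sub (.add (reg 3) (const 1)) (reg 4)) <|
    seq (flip 15) <| seq (assign 5 (.add (reg 5) (mul (reg 15) (reg 4)))) <|
    seq (assign 4 (mul (const 2) (reg 4))) <| assign 6 (.add (reg 6) (const 1))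

/-- The number of hash values. -/
def rangeExpr (κ : ℕ) : RamExpr := prodRange (fun _ => reg 7) κ

def hashExpr (κ : ℕ) (e : RamExpr) : RamExpr :=
  div (mul (mod (mul (reg 5) e) (reg 4)) (rangeExpr κ)) (reg 4)

/-- The base-`(N + 1)` digits of register 10 are the guesses, from the lowest: the excess over the
rounded threshold, the number of wraps, and the offset less one. -/
def targetExpr (κ : ℕ) : RamExpr :=
  .add (.add
    (hashExpr κ (.add (div (sub (.add (reg 1) (reg 9)) (const 1)) (reg 9))
      (mod (reg 10) (.add (reg 2) (const 1)))))
    (mul (mod (div (reg 10) (.add (reg 2) (const 1))) (.add (reg 2) (const 1))) (rangeExpr κ)))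
    (.add (div (reg 10) (mul (.add (reg 2) (const 1)) (.add (reg 2) (const 1)))) (const 1))

def entryExpr (κ : ℕ) : RamExpr :=
  mul (flag (cell 0 (reg 8)))
    (.add (hashExpr κ (div (sub (cell 0 (reg 8)) (const 1)) (reg 9))) (const 2))

/-- Write the instance that belongs to the level in the register 9 and the index in the
register 10. -/
def emitProg (κ : ℕ) : RamProg :=
  seq (writeOut (reg 0)) <| seq (writeOut (targetExpr κ)) <| forUp 8 (reg 2) <|
    writeOut (entryExpr κ)

/-- Write all instances, and run `fin` after each of them. -/
def hashProg (κ : ℕ) (fin : RamProg) : RamProg :=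
  seq (assign 9 (const 1)) <|
  loop (sub (.add (reg 3) (const 1)) (reg 9)) <|
    seq (forUp 10 (prodRange (fun _ => .add (reg 2) (const 1)) 3) (seq (emitProg κ) fin)) <|
    assign 9 (mul (const 2) (reg 9))

/-- The `i`-th vertex of the tuple whose position is in the register 8. -/
def digitExpr (i : ℕ) : RamExpr := mod (div (reg 8) (prodRange (fun _ => reg 0) i)) (reg 0)

/-- Whether the tuple is strictly increasing and lies in the set given by the register 11. -/
def selectExpr (d : ℕ) : RamExpr :=
  flag <| mul (prodRange (fun i => mod (div (reg 11) (cell 1 (digitExpr i))) (const 2)) d)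
    (prodRange (fun i => sub (digitExpr (i + 1)) (digitExpr i)) (d - 1))

/-- Solve the maximization problem by trying all sets of vertices. -/
def bruteProg (d : ℕ) : RamProg :=
  forUp 11 (reg 7) <| seq (assign 12 (const 0)) <| seq (assign 13 (const 0)) <|
    seq (forUp 8 (reg 2) <|
      seq (assign 12 (.add (reg 12) (mul (selectExpr d) (sub (cell 0 (reg 8)) (const 1))))) <|
        assign 13 (.add (reg 13) (mul (selectExpr d) (sub (const 1) (cell 0 (reg 8)))))) <|
    assign 14 (flag (.add (reg 14)
      (mul (sub (const 1) (reg 13)) (sub (.add (reg 12) (const 1)) (reg 1)))))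

/-- Register 6 holds the number of levels less one. The test is nonzero exactly when this is at most
`2 ^ n`, the regime in which hashing is reliable. -/
def mainProg (d κ : ℕ) (fin hashEnd bruteEnd : RamProg) : RamProg :=
  seq (readProg d) <| seq powersProg <| seq randomProg <|
  cond (sub (.add (reg 7) (const 1)) (reg 6)) (seq (hashProg κ fin) hashEnd)
    (seq (bruteProg d) bruteEnd)

/-! ### What the program computes -/

/-- A number exceeding everything of interest. -/
def upper (t N : ℕ) (A : ℕ → ℕ) : ℕ := t + N + 1 + ∑ k ∈ Finset.range N, A k

/-- The number of rounding levels. -/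
def levels (t N : ℕ) (A : ℕ → ℕ) : ℕ := (upper t N A).size

def hashTarget (t N a H Q P g : ℕ) : ℕ :=
  mulShift a H Q (divUp t P + g % (N + 1)) + g / (N + 1) % (N + 1) * Q +
    (g / ((N + 1) * (N + 1)) + 1)

/-- Of the 2, one unit belongs to the hashed weight, which is shifted to make the rounding offset
positive; the other marks a hyperedge in the tensor. -/
def hashEntry (a H Q P x : ℕ) : ℕ := if x = 0 then 0 else mulShift a H Q ((x - 1) / P) + 2

def hashWord (n t N : ℕ) (A : ℕ → ℕ) (a H Q P g : ℕ) : List ℕ :=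
  n :: hashTarget t N a H Q P g :: (List.range N).map fun k => hashEntry a H Q P (A k)

def hashWords (n t N : ℕ) (A : ℕ → ℕ) (a H Q K : ℕ) : List (List ℕ) :=
  (List.range K).flatMap fun k =>
    (List.range ((N + 1) ^ 3)).map fun g => hashWord n t N A a H Q (2 ^ k) g

/-- The tuple of vertices in position `k` is strictly increasing and lies in the set given by the
binary digits of `mask`. -/
def Selected (d n mask k : ℕ) : Prop :=
  (∀ i < d, mask / 2 ^ (k / n ^ i % n) % 2 ≠ 0) ∧
    ∀ i < d - 1, k / n ^ i % n < k / n ^ (i + 1) % n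

open Classical in
/-- Some set of vertices passes the test of the exhaustive search. -/
def BruteYes (d n t N : ℕ) (A : ℕ → ℕ) (masks : ℕ) : Prop :=
  ∃ mask < masks,
    (∑ k ∈ Finset.range N, if Selected d n mask k then 1 - A k else 0) = 0 ∧
    t ≤ ∑ k ∈ Finset.range N, if Selected d n mask k then A k - 1 else 0

/-! ### Correctness -/

structure Loaded (n t N U : ℕ) (A : ℕ → ℕ) (reg : ℕ → ℕ) (arr : ℕ → ℕ → ℕ) : Prop where
  r0 : reg 0 = n
  r1 : reg 1 = t
  r2 : reg 2 = N
  r3 : reg 3 = U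
  arr0 : ∀ k < N, arr 0 k = A k

structure Ready (n t N U a H : ℕ) (A : ℕ → ℕ) (reg : ℕ → ℕ) (arr : ℕ → ℕ → ℕ) : Prop extends
    Loaded n t N U A reg arr where
  r4 : reg 4 = H
  r5 : reg 5 = a
  r7 : reg 7 = 2 ^ n
  arr1 : ∀ v < n, arr 1 v = 2 ^ v

/-- Registers from 8 on are scratch space. -/
theorem Ready.congr {n t N U a H : ℕ} {A : ℕ → ℕ} {reg reg' : ℕ → ℕ} {arr arr' : ℕ → ℕ → ℕ}
    (h : Ready n t N U a H A reg arr) (hr : ∀ i < 8, reg' i = reg i) (ha : arr' = arr) :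
    Ready n t N U a H A reg' arr' := by
  subst ha
  constructor
  · constructor <;> first | (rw [hr _ (by norm_num)]) | skip
    exacts [h.r0, h.r1, h.r2, h.r3, h.arr0]
  all_goals first | (rw [hr _ (by norm_num)]) | skip
  exacts [h.r4, h.r5, h.r7, h.arr1]

theorem Ready.setReg {n t N U a H : ℕ} {A : ℕ → ℕ} {s : RamState}
    (h : Ready n t N U a H A s.reg s.arr) {i : ℕ} (hi : 8 ≤ i) (v : ℕ) :
    Ready n t N U a H A (s.setReg i v).reg (s.setReg i v).arr :=
  h.congr (fun j hj => by rw [RamState.setReg_reg, if_neg (by omega)]) rfl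

section

variable {O : List ℕ → Bool} {V R : ℕ} {n t N d κ : ℕ} {A : ℕ → ℕ}

theorem two_le_upper (ht : 0 < t) : 2 ≤ upper t N A := by
  unfold upper
  omega

theorem upper_lt : upper t N A < 2 ^ levels t N A := Nat.lt_size_self _

theorem wp_readProg (hN : N = n ^ d) (hnV : n ≤ V) (hUV : upper t N A ≤ V) (hR : N ≤ R)
    (r : List Bool) {Q : RamState → Prop}
    (hQ : ∀ s, Loaded n t N (upper t N A) A s.reg s.arr → s.reg 6 = 0 → s.reg 14 = 0 →
      s.output = [] → s.coins = r → s.queries = [] → Q s) :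
    (readProg d).Wp O V R (.init (n :: t :: (List.range N).map A) r) Q := by
  have hsum (k : ℕ) (hk : k ≤ N) :
      t + N + 1 + ∑ j ∈ Finset.range k, A j ≤ upper t N A := by
    unfold upper
    gcongr
  have hA (k : ℕ) (hk : k < N) : A k ≤ V := by
    refine le_trans ?_ hUV
    have := Finset.single_le_sum (f := A) (fun _ _ => Nat.zero_le _) (Finset.mem_range.2 hk)
    unfold upper
    omega
  have hU : t + N + 1 ≤ V := by
    refine le_trans ?_ hUV
    unfold upper
    omega
  refine wp_seq (wp_readIn (by simpa [RamState.init] using hnV) ?_)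
  refine wp_seq (wp_readIn (by simp [RamState.init]; omega) ?_)
  refine wp_seq (wp_assign (by simp [eval_prodRange, eval, RamState.init, ← hN]; omega) ?_)
  refine wp_seq (wp_assign (by
    simpa [eval_prodRange, eval, RamState.init, ← hN] using hU) ?_)
  refine wp_forUp (fun k s => s.reg 0 = n ∧ s.reg 1 = t ∧ s.reg 2 = N ∧
    s.reg 3 = t + N + 1 + ∑ j ∈ Finset.range k, A j ∧ s.reg 6 = 0 ∧ s.reg 14 = 0 ∧
    (∀ j < k, s.arr 0 j = A j) ∧ s.input = ((List.range N).map A).drop k ∧ s.output = [] ∧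
    s.coins = r ∧ s.queries = []) N hR (by omega) ?_ ?_ ?_ ?_
  · simp [eval_prodRange, eval, RamState.init, ← hN]
  · simp +contextual [eval]
  · rintro k hk s ⟨h0, h1, h2, h3, h6, h14, harr, hin, hout, hcoin, hq⟩ h8
    have hdrop : ((List.range N).map A).drop k = A k :: ((List.range N).map A).drop (k + 1) := by
      rw [List.drop_eq_getElem_cons (by simpa using hk)]
      simp
    rw [hdrop] at hin
    refine wp_seq (wp_readIn (by simpa [hin] using hA k hk) ?_)
    refine wp_seq (wp_store (by simpa [hin, eval] using hA k hk) ?_)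
    refine wp_assign ?_ ?_
    · refine le_trans ?_ ((hsum (k + 1) hk).trans hUV)
      simp [hin, eval, h3, Finset.sum_range_succ, add_assoc]
    · refine ⟨by simp [h8], by simp [h0], by simp [h1], by simp [h2], ?_, by simp [h6],
        by simp [h14], ?_, by simp [hin], hout, hcoin, hq⟩
      · simp [hin, eval, h3, Finset.sum_range_succ, add_assoc]
      · intro j hj
        simp only [eval, RamState.setReg_arr, RamState.setCell_arr, RamState.setReg_reg, h8, hin]
        rcases Nat.lt_succ_iff_lt_or_eq.1 hj with hj | rfl
        · simp [hj.ne, harr j hj]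
        · simp
  · rintro s ⟨h0, h1, h2, h3, h6, h14, harr, hin, hout, hcoin, hq⟩
    exact hQ s ⟨h0, h1, h2, h3, harr⟩ h6 h14 hout hcoin hq

theorem wp_powersProg {U : ℕ} {s : RamState} (hs : Loaded n t N U A s.reg s.arr)
    (hV : 2 ^ n ≤ V) (hR : n ≤ R) {Q : RamState → Prop}
    (hQ : ∀ s', Loaded n t N U A s'.reg s'.arr → s'.reg 7 = 2 ^ n →
      (∀ v < n, s'.arr 1 v = 2 ^ v) → s'.reg 6 = s.reg 6 → s'.reg 14 = s.reg 14 →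
      s'.output = s.output → s'.coins = s.coins → s'.queries = s.queries → Q s') :
    powersProg.Wp O V R s Q := by
  have hpow (k : ℕ) (hk : k ≤ n) : 2 ^ k ≤ V := (Nat.pow_le_pow_right two_pos hk).trans hV
  refine wp_seq (wp_assign (hpow 0 (Nat.zero_le _)) ?_)
  refine wp_forUp (fun k s' => Loaded n t N U A s'.reg s'.arr ∧ s'.reg 7 = 2 ^ k ∧
      (∀ v < k, s'.arr 1 v = 2 ^ v) ∧ s'.reg 6 = s.reg 6 ∧ s'.reg 14 = s.reg 14 ∧
      s'.output = s.output ∧ s'.coins = s.coins ∧ s'.queries = s.queries) n hR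
      (Nat.lt_two_pow_self.le.trans hV) ?_ ?_ ?_ ?_
  · refine ⟨⟨by simp [hs.r0], by simp [hs.r1], by simp [hs.r2], by simp [hs.r3], hs.arr0⟩, ?_⟩
    simp [eval]
  · rintro k s' ⟨h, -⟩
    exact h.r0
  · rintro k hk s' ⟨h, h7, harr, h6, h14, hout, hcoin, hq⟩ h8
    refine wp_seq (wp_store ?_ ?_)
    · simpa [eval, h7] using hpow k hk.le
    · refine wp_assign ?_ ?_
      · simpa [eval, h7, pow_succ'] using hpow (k + 1) hk
      · refine ⟨by simp [h8], ⟨by simp [h.r0], by simp [h.r1], by simp [h.r2], by simp [h.r3],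
          by simpa using h.arr0⟩, by simp [eval, h7, pow_succ'], ?_, by simp [h6], by simp [h14],
          hout, hcoin, hq⟩
        intro v hv
        simp only [eval, RamState.setReg_arr, RamState.setCell_arr, h8]
        rcases Nat.lt_succ_iff_lt_or_eq.1 hv with hv | rfl
        · simp [hv.ne, harr v hv]
        · simp [h7]
  · rintro s' ⟨h, h7, harr, h6, h14, hout, hcoin, hq⟩
    exact hQ s' h h7 harr h6 h14 hout hcoin hq

theorem coinValue_take_succ (r : List Bool) (k : ℕ) :
    coinValue (r.take (k + 1)) = coinValue (r.take k) + 2 ^ k * ((r.drop k).headD false).toNat := by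
  rcases lt_or_ge k r.length with hk | hk
  · rw [List.take_succ_eq_append_getElem hk, coinValue_append, List.length_take, min_eq_left hk.le,
      List.drop_eq_getElem_cons hk]
    simp [coinValue, hk]
  -- Past the end of the tape the coin read is `false`, which adds nothing.
  · rw [List.take_of_length_le (by omega), List.take_of_length_le hk, List.drop_of_length_le hk]
    simp

theorem wp_randomProg {U : ℕ} (hU : 2 ≤ U) {s : RamState} (hs : Loaded n t N U A s.reg s.arr)
    (h7 : s.reg 7 = 2 ^ n) (h1 : ∀ v < n, s.arr 1 v = 2 ^ v) (h6 : s.reg 6 = 0)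
    (hV : 2 ^ U.size ≤ V) (hR : U.size ≤ R) {Q : RamState → Prop}
    (hQ : ∀ s', Ready n t N U (1 + 2 * coinValue (s.coins.take (U.size - 1))) (2 ^ U.size) A
        s'.reg s'.arr → s'.reg 6 = U.size - 1 → s'.reg 14 = s.reg 14 →
      s'.output = s.output → s'.queries = s.queries → Q s') :
    randomProg.Wp O V R s Q := by
  have hsize : 1 < U.size := Nat.lt_size.2 hU
  have hpow (k : ℕ) (hk : k ≤ U.size) : 2 ^ k ≤ V := (Nat.pow_le_pow_right two_pos hk).trans hV
  have ha (k : ℕ) (hk : k ≤ U.size - 1) : 1 + 2 * coinValue (s.coins.take k) ≤ V := by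
    refine le_trans ?_ (hpow (k + 1) (by omega))
    have := coinValue_lt (s.coins.take k)
    have h2 : 2 ^ (s.coins.take k).length ≤ 2 ^ k :=
      Nat.pow_le_pow_right two_pos (List.length_take_le _ _)
    rw [pow_succ]
    omega
  refine wp_seq (wp_assign (hpow 1 hsize.le) ?_)
  refine wp_seq (wp_assign (hpow 0 (Nat.zero_le _)) ?_)
  -- The modulus starts at 2 and the multiplier at 1, so coin `k` has weight `2 ^ (k + 1)`, the
  -- multiplier stays odd, and the modulus reaches `2 ^ U.size` after `U.size - 1` coins.
  refine wp_loop (fun k s' => Ready n t N U (1 + 2 * coinValue (s.coins.take k)) (2 ^ (k + 1)) A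
        s'.reg s'.arr ∧ s'.reg 6 = k ∧ s'.reg 14 = s.reg 14 ∧
        s'.output = s.output ∧ s'.queries = s.queries ∧ s'.coins = s.coins.drop k) (U.size - 1)
        (by omega) ?_ ?_ ?_
  · refine ⟨⟨⟨by simp [hs.r0], by simp [hs.r1], by simp [hs.r2], by simp [hs.r3], hs.arr0⟩,
      by simp [eval], by simp [eval, coinValue_nil], by simp [h7], by simpa using h1⟩, ?_⟩
    simp [h6]
  · rintro k hk s' ⟨h, h6, h14, hout, hq, hcoin⟩
    refine ⟨?_, ?_⟩
    · have := Nat.lt_size.1 (show k + 1 < U.size by omega)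
      simp only [eval, h.r3, h.r4]
      omega
    · have hval : 1 + 2 * coinValue (List.take k s.coins) +
          ((s.coins.drop k).headD false).toNat * 2 ^ (k + 1) =
          1 + 2 * coinValue (List.take (k + 1) s.coins) := by
        rw [coinValue_take_succ]
        ring
      refine wp_seq (wp_flip ?_)
      refine wp_seq (wp_assign ?_ ?_)
      · have := ha (k + 1) (by omega)
        simp only [eval, RamState.setReg_reg, h.r4, h.r5, hcoin]
        simpa only [Nat.reduceEqDiff, ↓reduceIte, hval] using this
      refine wp_seq (wp_assign ?_ ?_)
      · have := hpow (k + 2) (by omega)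
        simpa [eval, h.r4, pow_succ, mul_comm, mul_assoc] using this
      refine wp_assign ?_ ?_
      · have := Nat.lt_two_pow_self.le.trans (hpow (k + 1) (by omega))
        simpa [eval, h6] using this
      · refine ⟨⟨⟨by simp [h.r0], by simp [h.r1], by simp [h.r2], by simp [h.r3], h.arr0⟩, ?_, ?_,
          by simp [h.r7], by simpa using h.arr1⟩, by simp [eval, h6], by simp [h14], hout, hq, ?_⟩
        · simp [eval, h.r4, pow_succ, mul_comm, mul_assoc]
        · rw [← hval]
          simp [eval, h.r4, h.r5, hcoin]
        · simp [hcoin]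
  · rintro s' ⟨h, h6, h14, hout, hq, hcoin⟩
    rw [Nat.sub_add_cancel hsize.le] at h
    refine ⟨?_, hQ s' h h6 h14 hout hq⟩
    have := Nat.lt_size_self U
    simp only [eval, h.r3, h.r4]
    omega

/-! ### Writing the hashed instances. -/

theorem eval_hashExpr {U a H : ℕ} {s : RamState} (hs : Ready n t N U a H A s.reg s.arr)
    (κ : ℕ) (e : RamExpr) :
    (hashExpr κ e).eval s = mulShift a H ((2 ^ n) ^ κ) (e.eval s) := by
  simp [hashExpr, rangeExpr, eval, eval_prodRange, hs.r4, hs.r5, hs.r7, mulShift]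

theorem eval_targetExpr {U a H : ℕ} {s : RamState} (hs : Ready n t N U a H A s.reg s.arr)
    (κ : ℕ) :
    (targetExpr κ).eval s = hashTarget t N a H ((2 ^ n) ^ κ) (s.reg 9) (s.reg 10) := by
  simp [targetExpr, rangeExpr, eval_hashExpr hs, eval, eval_prodRange, hs.r1, hs.r2, hs.r7,
    hashTarget, divUp]

theorem eval_entryExpr {U a H : ℕ} {s : RamState} (hs : Ready n t N U a H A s.reg s.arr)
    (κ : ℕ) (h8 : s.reg 8 < N) :
    (entryExpr κ).eval s = hashEntry a H ((2 ^ n) ^ κ) (s.reg 9) (A (s.reg 8)) := by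
  simp only [entryExpr, eval_hashExpr hs, eval, eval_flag, hs.arr0 _ h8, hashEntry]
  split_ifs <;> simp

theorem wp_emitProg {U a H : ℕ} {s : RamState} (hs : Ready n t N U a H A s.reg s.arr)
    (hV : N ≤ V) (hR : N ≤ R) {Q : RamState → Prop}
    (hQ : ∀ s', s'.output = s.output ++
        hashWord n t N A a H ((2 ^ n) ^ κ) (s.reg 9) (s.reg 10) → s'.queries = s.queries →
        s'.arr = s.arr → (∀ i ≠ 8, s'.reg i = s.reg i) → Q s') :
    (emitProg κ).Wp O V R s Q := by
  refine wp_seq (wp_writeOut ?_)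
  refine wp_seq (wp_writeOut ?_)
  refine wp_forUp (fun k s' => s'.output = s.output ++ (n ::
      hashTarget t N a H ((2 ^ n) ^ κ) (s.reg 9) (s.reg 10) ::
      (List.range k).map fun k => hashEntry a H ((2 ^ n) ^ κ) (s.reg 9) (A k)) ∧
      s'.queries = s.queries ∧ s'.arr = s.arr ∧ ∀ i ≠ 8, s'.reg i = s.reg i) N hR hV ?_ ?_ ?_ ?_
  · have htarget (out : List ℕ) : (targetExpr κ).eval { s with output := out } =
        hashTarget t N a H ((2 ^ n) ^ κ) (s.reg 9) (s.reg 10) :=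
      eval_targetExpr (s := { s with output := out }) hs κ
    simp +contextual [eval, hs.r0, htarget]
  · rintro k s' ⟨-, -, -, h⟩
    simpa [eval, h] using hs.r2
  · rintro k hk s' ⟨hout, hq, harr, hreg⟩ h8
    have hs' : Ready n t N U a H A s'.reg s'.arr := hs.congr (fun i hi => hreg i (by omega)) harr
    refine wp_writeOut ⟨h8, ?_, hq, harr, ?_⟩
    · rw [eval_entryExpr hs' κ (by omega)]
      simp [hout, List.range_succ, h8, hreg 9]
    · intro i hi
      simp [hi, hreg i hi]
  · rintro s' ⟨hout, hq, harr, hreg⟩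
    exact hQ s' hout hq harr hreg

/-- The program `fin` turns the state of the tapes and of the register 14 that belongs to the list
`L` of instances into the one that belongs to `L` extended by the instance just written. -/
def Collects (O : List ℕ → Bool) (V R : ℕ) (fin : RamProg)
    (E : List (List ℕ) → List ℕ → List (List ℕ) → ℕ → Prop) : Prop :=
  ∀ (L : List (List ℕ)) (w out : List ℕ) (s : RamState), s.output = out ++ w →
    E L out s.queries (s.reg 14) → fin.Wp O V R s fun s' =>
      E (L ++ [w]) s'.output s'.queries (s'.reg 14) ∧ s'.arr = s.arr ∧
        ∀ i, i ≠ 14 → i ≠ 16 → s'.reg i = s.reg i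

/-- The relation `E` abstracts from what happens after each instance, so the same argument serves
the reduction and the kernel. -/
theorem wp_hashProg {U a : ℕ} {s : RamState} (hs : Ready n t N U a (2 ^ U.size) A s.reg s.arr)
    {fin : RamProg} {E : List (List ℕ) → List ℕ → List (List ℕ) → ℕ → Prop}
    (hfin : Collects O V R fin E) (hE : E [] s.output s.queries (s.reg 14))
    (hV : (N + 1) ^ 3 ≤ V) (hVU : 2 ^ U.size ≤ V) (hR : (N + 1) ^ 3 ≤ R) (hRU : U.size ≤ R)
    {Q : RamState → Prop}
    (hQ : ∀ s', E (hashWords n t N A a (2 ^ U.size) ((2 ^ n) ^ κ) U.size) s'.output s'.queries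
      (s'.reg 14) → Q s') :
    (hashProg κ fin).Wp O V R s Q := by
  have hN : N ≤ (N + 1) ^ 3 := (Nat.le_succ N).trans (Nat.le_self_pow (by norm_num) _)
  have hpow (k : ℕ) (hk : k ≤ U.size) : 2 ^ k ≤ V := (Nat.pow_le_pow_right two_pos hk).trans hVU
  refine wp_seq (wp_assign (hpow 0 (Nat.zero_le _)) ?_)
  refine wp_loop (fun k s' => Ready n t N U a (2 ^ U.size) A s'.reg s'.arr ∧ s'.reg 9 = 2 ^ k ∧
    E (hashWords n t N A a (2 ^ U.size) ((2 ^ n) ^ κ) k) s'.output s'.queries (s'.reg 14)) U.size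
    hRU ?_ ?_ ?_
  · exact ⟨hs.setReg (by norm_num) _, by simp [eval], by simpa [hashWords] using hE⟩
  · rintro k hk s₁ ⟨hs₁, h9, hE₁⟩
    refine ⟨?_, wp_seq ?_⟩
    · have := Nat.lt_size.1 hk
      simp only [eval, hs₁.r3, h9]
      omega
    refine wp_forUp (fun g s' => Ready n t N U a (2 ^ U.size) A s'.reg s'.arr ∧ s'.reg 9 = 2 ^ k ∧
      E (hashWords n t N A a (2 ^ U.size) ((2 ^ n) ^ κ) k ++ (List.range g).map fun g =>
        hashWord n t N A a (2 ^ U.size) ((2 ^ n) ^ κ) (2 ^ k) g)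
        s'.output s'.queries (s'.reg 14)) ((N + 1) ^ 3) hR hV ?_ ?_ ?_ ?_
    · exact ⟨hs₁.setReg (by norm_num) _, by simpa using h9, by simpa using hE₁⟩
    · rintro g s' ⟨hs', -⟩
      simp [eval, eval_prodRange, hs'.r2]
    · rintro g hg s₂ ⟨hs₂, h9, hE₂⟩ h10
      refine wp_seq (wp_emitProg hs₂ (hN.trans hV) (hN.trans hR) ?_)
      rintro s₃ hout hq harr hreg
      refine (hfin _ _ _ s₃ hout (by rw [hq, hreg 14 (by norm_num)]; exact hE₂)).mono ?_
      rintro s₄ ⟨hE₄, harr', hreg'⟩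
      have hreg₄ (i : ℕ) (h8 : i ≠ 8) (h14 : i ≠ 14) (h16 : i ≠ 16) : s₄.reg i = s₂.reg i :=
        (hreg' i h14 h16).trans (hreg i h8)
      refine ⟨by rw [hreg₄ 10 (by norm_num) (by norm_num) (by norm_num), h10], ?_, ?_, ?_⟩
      · refine Ready.setReg (hs₂.congr (fun i hi => ?_) (harr'.trans harr)) (by norm_num) _
        exact hreg₄ i (by omega) (by omega) (by omega)
      · simpa [h9] using hreg₄ 9 (by norm_num) (by norm_num) (by norm_num)
      · simpa [List.range_succ, h9, h10] using hE₄
    · rintro s₂ ⟨hs₂, h9, hE₂⟩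
      refine wp_assign ?_ ⟨hs₂.setReg (by norm_num) _, ?_, ?_⟩
      · simpa [eval, h9, pow_succ'] using hpow (k + 1) hk
      · simp [eval, h9, pow_succ']
      · simpa [hashWords, List.range_succ] using hE₂
  · rintro s' ⟨hs', h9, hE'⟩
    refine ⟨?_, hQ s' hE'⟩
    have := Nat.lt_size_self U
    simp only [eval, hs'.r3, h9]
    omega

/-! ### Exhaustive search. -/

open Classical in
theorem eval_selectExpr {U a H : ℕ} {s : RamState} (hs : Ready n t N U a H A s.reg s.arr)
    (hn : 0 < n) (d : ℕ) :
    (selectExpr d).eval s = if Selected d n (s.reg 11) (s.reg 8) then 1 else 0 := by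
  have hdigit (i : ℕ) : (digitExpr i).eval s = s.reg 8 / n ^ i % n := by
    simp [digitExpr, eval, eval_prodRange, hs.r0]
  have h₁ : ∀ i, s.arr 1 (s.reg 8 / n ^ i % n) = 2 ^ (s.reg 8 / n ^ i % n) := fun i =>
    hs.arr1 _ (Nat.mod_lt _ hn)
  rw [selectExpr, eval_flag, ← ite_not]
  refine if_congr ?_ rfl rfl
  simp only [eval, eval_prodRange, hdigit, h₁, Selected, mul_eq_zero, not_or,
    Finset.prod_eq_zero_iff, Finset.mem_range, not_exists, not_and, Nat.sub_eq_zero_iff_le, not_le]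

/-- With truncated subtraction, `1 - A k` counts the selected tuples that are not hyperedges, and `A
k - 1` recovers the weights of those that are. -/
theorem wp_bruteProg {U a H : ℕ} (hn : 0 < n) {s : RamState}
    (hs : Ready n t N U a H A s.reg s.arr) (h14 : s.reg 14 = 0)
    (hV : 2 ^ n ≤ V) (hVU : ∑ k ∈ Finset.range N, A k ≤ V) (hVN : N ≤ V)
    (hR : 2 ^ n ≤ R) (hRN : N ≤ R) {Q : RamState → Prop}
    (hQ : ∀ s', (s'.reg 14 = 0 ∧ ¬ BruteYes d n t N A (2 ^ n) ∨
        s'.reg 14 = 1 ∧ BruteYes d n t N A (2 ^ n)) → s'.output = s.output →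
        s'.queries = s.queries → Q s') :
    (bruteProg d).Wp O V R s Q := by
  classical
  have hV1 : 1 ≤ V := Nat.one_le_two_pow.trans hV
  refine wp_forUp (fun m s' => Ready n t N U a H A s'.reg s'.arr ∧
    (s'.reg 14 = 0 ∧ ¬ BruteYes d n t N A m ∨ s'.reg 14 = 1 ∧ BruteYes d n t N A m) ∧
    s'.output = s.output ∧ s'.queries = s.queries) (2 ^ n) hR hV ?_ ?_ ?_ ?_
  · refine ⟨hs.setReg (by norm_num) _, Or.inl ⟨by simpa using h14, ?_⟩, rfl, rfl⟩
    rintro ⟨m, hm, -⟩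
    omega
  · rintro m s' ⟨hs', -⟩
    exact hs'.r7
  · rintro m hm s₁ ⟨hs₁, h14, hout, hq⟩ h11
    refine wp_seq (wp_assign (Nat.zero_le _) ?_)
    refine wp_seq (wp_assign (Nat.zero_le _) ?_)
    refine wp_seq ?_
    have hstep (k : ℕ) (hk : k < N) (f : ℕ → ℕ) :
        ∑ k ∈ Finset.range (k + 1), f k ≤ ∑ k ∈ Finset.range N, f k :=
      Finset.sum_le_sum_of_subset (Finset.range_mono hk)
    refine wp_forUp (fun k s' => Ready n t N U a H A s'.reg s'.arr ∧ s'.reg 11 = m ∧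
      s'.reg 12 = (∑ k ∈ Finset.range k, if Selected d n m k then A k - 1 else 0) ∧
      s'.reg 13 = (∑ k ∈ Finset.range k, if Selected d n m k then 1 - A k else 0) ∧
      s'.reg 14 = s₁.reg 14 ∧ s'.output = s.output ∧ s'.queries = s.queries) N hRN hVN ?_ ?_ ?_ ?_
    · refine ⟨((hs₁.setReg ?_ _).setReg ?_ _).setReg ?_ _, ?_⟩ <;> simp [h11, eval, hout, hq]
    · rintro k s' ⟨hs', -⟩
      exact hs'.r2
    · rintro k hk s₂ ⟨hs₂, h11, h12, h13, h14, hout, hq⟩ h8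
      refine wp_seq (wp_assign ?_ (wp_assign ?_ ?_))
      · simp only [eval, eval_selectExpr hs₂ hn, h12, h11, h8, hs₂.arr0 k hk, ite_mul, one_mul,
          zero_mul, ← Finset.sum_range_succ]
        refine (hstep k hk _).trans (le_trans (Finset.sum_le_sum fun k _ => ?_) hVU)
        split_ifs <;> omega
      · simp only [eval, eval_selectExpr (hs₂.setReg (show 8 ≤ 12 by norm_num) _) hn]
        simp only [RamState.setReg_reg, RamState.setReg_arr, h13, h11, h8, hs₂.arr0 k hk, ite_mul,
          one_mul, zero_mul, Nat.reduceEqDiff, ↓reduceIte, ← Finset.sum_range_succ]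
        refine (hstep k hk _).trans (le_trans (Finset.sum_le_card_nsmul _ _ 1 fun k _ => ?_) ?_)
        · split_ifs <;> omega
        · simpa using hVN
      · refine ⟨by simp [h8], ((hs₂.setReg ?_ _).setReg ?_ _).setReg ?_ _, by simp [h11], ?_, ?_,
          by simp [h14], hout, hq⟩
        · norm_num
        · norm_num
        · norm_num
        · simp only [eval, eval_selectExpr hs₂ hn]
          simp [h12, h11, h8, hs₂.arr0 k hk, Finset.sum_range_succ]
        · simp only [eval, eval_selectExpr (hs₂.setReg (show 8 ≤ 12 by norm_num) _) hn]
          simp [h13, h11, h8, hs₂.arr0 k hk, Finset.sum_range_succ]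
    · rintro s₂ ⟨hs₂, h11, h12, h13, h14', hout, hq⟩
      refine wp_assign ?_ ⟨by simp [h11], (hs₂.setReg ?_ _).setReg ?_ _, ?_, hout, hq⟩
      · rw [eval_flag]
        split_ifs <;> omega
      · norm_num
      · norm_num
      · have hsucc : BruteYes d n t N A (m + 1) ↔ BruteYes d n t N A m ∨
            (∑ k ∈ Finset.range N, if Selected d n m k then 1 - A k else 0) = 0 ∧
            t ≤ ∑ k ∈ Finset.range N, if Selected d n m k then A k - 1 else 0 := by
          constructor
          · rintro ⟨m', hm', h⟩
            rcases Nat.lt_succ_iff_lt_or_eq.1 hm' with hm' | rfl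
            exacts [.inl ⟨m', hm', h⟩, .inr h]
          · rintro (⟨m', hm', h⟩ | h)
            exacts [⟨m', by omega, h⟩, ⟨m, by omega, h⟩]
        rw [hsucc]
        simp only [RamState.setReg_reg, eval_flag, eval, h12, h13, h14', hs₂.r1]
        rw [if_pos trivial, if_neg (show ¬ 14 = 11 by norm_num)]
        generalize (∑ k ∈ Finset.range N, if Selected d n m k then 1 - A k else 0) = b at *
        generalize (∑ k ∈ Finset.range N, if Selected d n m k then A k - 1 else 0) = w at *
        rcases h14 with ⟨h14, hno⟩ | ⟨h14, hyes⟩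
        · rw [h14, zero_add]
          by_cases hb : b = 0 ∧ t ≤ w
          · right
            refine ⟨if_neg (mul_ne_zero ?_ ?_), .inr hb⟩ <;> omega
          · left
            refine ⟨if_pos ?_, by tauto⟩
            rw [Nat.mul_eq_zero]
            omega
        · right
          exact ⟨if_neg (by omega), .inl hyes⟩
  · rintro s' ⟨-, h14, hout, hq⟩
    exact hQ s' h14 hout hq

theorem wp_mainProg (ht : 0 < t) (hn : 0 < n) (hN : N = n ^ d) (hVZ : 2 ^ n ≤ V)
    (hVU : 2 ^ levels t N A ≤ V) (hVN : (N + 1) ^ 3 ≤ V) (hRn : n ≤ R)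
    (hRU : levels t N A ≤ R) (hRN : (N + 1) ^ 3 ≤ R) (r : List Bool)
    {fin hashEnd bruteEnd : RamProg} {E : List (List ℕ) → List ℕ → List (List ℕ) → ℕ → Prop}
    (hfin : Collects O V R fin E) (hE : E [] [] [] 0) {Q : RamState → Prop}
    (hhash : levels t N A - 1 ≤ 2 ^ n → ∀ s, E (hashWords n t N A
      (1 + 2 * coinValue (r.take (levels t N A - 1))) (2 ^ levels t N A) ((2 ^ n) ^ κ)
      (levels t N A)) s.output s.queries (s.reg 14) → hashEnd.Wp O V R s Q)
    (hbrute : 2 ^ n < levels t N A - 1 → ∀ s,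
      (s.reg 14 = 0 ∧ ¬ BruteYes d n t N A (2 ^ n) ∨
        s.reg 14 = 1 ∧ BruteYes d n t N A (2 ^ n)) → s.output = [] →
        s.queries = [] → bruteEnd.Wp O V R s Q) :
    (mainProg d κ fin hashEnd bruteEnd).Wp O V R (.init (n :: t :: (List.range N).map A) r) Q := by
  have hN' : N ≤ (N + 1) ^ 3 := (Nat.le_succ N).trans (Nat.le_self_pow (by norm_num) _)
  have hUV : upper t N A ≤ V := upper_lt.le.trans hVU
  refine wp_seq (wp_readProg hN (Nat.lt_two_pow_self.le.trans hVZ) hUV (hN'.trans hRN) r ?_)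
  intro s₁ hs₁ h6 h14 hout hcoin hq
  refine wp_seq (wp_powersProg hs₁ hVZ hRn ?_)
  intro s₂ hs₂ h7 h1 h6' h14' hout' hcoin' hq'
  refine wp_seq (wp_randomProg (two_le_upper ht) hs₂ h7 h1 (h6'.trans h6) hVU hRU ?_)
  intro s₃ hs₃ h6₃ h14₃ hout₃ hq₃
  rw [h14', h14] at h14₃
  rw [hout', hout] at hout₃
  rw [hq', hq] at hq₃
  rw [hcoin', hcoin] at hs₃
  refine wp_cond (fun h => wp_seq ?_) (fun h => wp_seq ?_)
  · refine wp_hashProg hs₃ hfin ?_ hVN hVU hRN hRU (hhash ?_)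
    · rwa [hout₃, hq₃, h14₃]
    · simp only [eval, hs₃.r7, h6₃] at h
      unfold levels
      omega
  -- The failed test is what bounds the `2 ^ n` rounds of the search by `R`.
  · have hlt : 2 ^ n < levels t N A - 1 := by
      simp only [eval, hs₃.r7, h6₃] at h
      unfold levels
      omega
    refine wp_bruteProg hn hs₃ h14₃ hVZ (le_trans ?_ hUV) (hN'.trans hVN)
      (by omega) (hN'.trans hRN) ?_
    · unfold upper
      omega
    · intro s' h h' h''
      exact hbrute hlt s' h (h'.trans hout₃) (h''.trans hq₃)

end

end HypercliqueProg

/-! ### Instances and the words encoding them -/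

namespace HypercliqueInstance

open HypercliqueProg

variable {d : ℕ} (I : HypercliqueInstance d)

/-- The entry of the weighted adjacency tensor that belongs to a set of vertices. -/
def setEntry (e : Finset (Fin I.n)) : ℕ := if e ∈ I.edges then I.w e + 1 else 0

/-- The entry in position `k` of the weighted adjacency tensor, and zero beyond its end. -/
def entry (k : ℕ) : ℕ :=
  if h : k < I.n ^ d then I.tensorEntry (finFunctionFinEquiv.symm ⟨k, h⟩) else 0

theorem entry_fin (k : Fin (I.n ^ d)) : I.entry k = I.tensorEntry (finFunctionFinEquiv.symm k) :=
  dif_pos k.2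

theorem encode_eq : I.encode = I.n :: I.t :: (List.range (I.n ^ d)).map I.entry := by
  rw [encode, ← List.map_coe_finRange_eq_range, List.map_map, ← List.ofFn_eq_map]
  simp [Function.comp_def, entry_fin]

/-- The set of vertices given by the binary digits of a number. -/
def maskSet (n mask : ℕ) : Finset (Fin n) := {x | mask / 2 ^ (x : ℕ) % 2 ≠ 0}

theorem exists_maskSet_eq {n : ℕ} (S : Finset (Fin n)) : ∃ mask < 2 ^ n, maskSet n mask = S := by
  refine ⟨finFunctionFinEquiv (fun x : Fin n => if x ∈ S then (1 : Fin 2) else 0), Fin.is_lt _, ?_⟩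
  ext x
  have := finFunctionFinEquiv_symm_apply_val
    (finFunctionFinEquiv (fun x : Fin n => if x ∈ S then (1 : Fin 2) else 0)) x
  rw [Equiv.symm_apply_apply] at this
  rw [maskSet, Finset.mem_filter, ← this]
  by_cases hx : x ∈ S <;> simp [hx]

theorem selected_iff (n mask : ℕ) (k : Fin (n ^ d)) :
    Selected d n mask k ↔ StrictMono (finFunctionFinEquiv.symm k) ∧
      Finset.univ.image (finFunctionFinEquiv.symm k) ⊆ maskSet n mask := by
  have hval (i : Fin d) : (k : ℕ) / n ^ (i : ℕ) % n = finFunctionFinEquiv.symm k i :=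
    (finFunctionFinEquiv_symm_apply_val k i).symm
  rw [Selected, and_comm]
  refine and_congr ?_ ?_
  · cases d with
    | zero => simp [StrictMono]
    | succ d =>
      rw [Fin.strictMono_iff_lt_succ]
      constructor
      · intro h i
        have := h i (by simp)
        rw [Fin.lt_def, ← hval, ← hval]
        exact this
      · intro h i hi
        have := h ⟨i, by omega⟩
        rw [Fin.lt_def, ← hval, ← hval] at this
        exact this
  · rw [Finset.image_subset_iff]
    constructor
    · intro h i _
      have := h i i.2
      rw [hval i] at this
      simpa [maskSet] using this
    · intro h i hi
      have := h ⟨i, hi⟩ (Finset.mem_univ _)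
      simpa [maskSet, ← hval] using this

/-- Strictly increasing tuples correspond to sets. -/
theorem sum_strictMono_eq {n : ℕ} {M : Type*} [AddCommMonoid M] (f : Finset (Fin n) → M)
    [DecidablePred fun v : Fin d → Fin n => StrictMono v] :
    ∑ v : Fin d → Fin n with StrictMono v, f (Finset.univ.image v) =
      ∑ e ∈ Finset.powersetCard d Finset.univ, f e := by
  refine Finset.sum_bij (fun v _ => Finset.univ.image v) ?_ ?_ ?_ ?_
  · intro v hv
    rw [Finset.mem_filter] at hv
    simp [Finset.mem_powersetCard, Finset.card_image_of_injective _ hv.2.injective]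
  · intro v hv v' hv' h
    rw [Finset.mem_filter] at hv hv'
    have hc : (Finset.univ.image v).card = d := by
      simp [Finset.card_image_of_injective _ hv.2.injective]
    rw [Finset.orderEmbOfFin_unique hc (fun x => by simp) hv.2]
    exact (Finset.orderEmbOfFin_unique hc (fun x => by rw [h]; simp) hv'.2).symm
  · intro e he
    rw [Finset.mem_powersetCard] at he
    exact ⟨e.orderEmbOfFin he.2, by simp [(e.orderEmbOfFin he.2).strictMono], by simp⟩
  · intros
    rfl

-- The tensor lists a set once per ordering, besides tuples with repetitions; strictly increasing
-- tuples pick each `d`-set exactly once.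
open Classical in
theorem sum_selected_eq (mask : ℕ) (f : ℕ → ℕ) :
    (∑ k ∈ Finset.range (I.n ^ d), if Selected d I.n mask k then f (I.entry k) else 0) =
      ∑ e ∈ Finset.powersetCard d Finset.univ,
        if e ⊆ maskSet I.n mask then f (I.setEntry e) else 0 := by
  rw [← sum_strictMono_eq, Finset.sum_filter,
    ← Fin.sum_univ_eq_sum_range fun k => if Selected d I.n mask k then f (I.entry k) else 0]
  rw [← Equiv.sum_comp finFunctionFinEquiv.symm]
  refine Finset.sum_congr rfl fun k _ => ?_
  simp only [selected_iff, entry_fin, ite_and]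
  rfl

theorem edges_subset : I.edges ⊆ Finset.powersetCard d Finset.univ := fun e he =>
  Finset.mem_powersetCard.2 ⟨Finset.subset_univ e, I.uniform e he⟩

theorem card_edges_le : I.edges.card ≤ I.n ^ d := by
  refine (Finset.card_le_card I.edges_subset).trans ?_
  rw [Finset.card_powersetCard, Finset.card_univ, Fintype.card_fin]
  exact Nat.choose_le_pow _ _

theorem card_edges_filter_le (S : Finset (Fin I.n)) :
    (I.edges.filter (· ⊆ S)).card ≤ I.n ^ d :=
  (Finset.card_filter_le _ _).trans I.card_edges_le

theorem weight_le_upper (S : Finset (Fin I.n)) : I.weight S ≤ upper I.t (I.n ^ d) I.entry := by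
  classical
  have h₁ : I.weight S ≤ ∑ e ∈ Finset.powersetCard d Finset.univ, I.setEntry e := by
    calc I.weight S ≤ ∑ e ∈ I.edges, I.w e :=
          Finset.sum_le_sum_of_subset (Finset.filter_subset _ _)
      _ ≤ ∑ e ∈ I.edges, I.setEntry e :=
          Finset.sum_le_sum fun e he => by simp [setEntry, he]
      _ ≤ _ := Finset.sum_le_sum_of_subset I.edges_subset
  have h₂ : ∑ e ∈ Finset.powersetCard d Finset.univ, I.setEntry e ≤
      ∑ k ∈ Finset.range (I.n ^ d), I.entry k := by
    rw [← sum_strictMono_eq, ← Fin.sum_univ_eq_sum_range I.entry,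
      ← Equiv.sum_comp finFunctionFinEquiv]
    simp only [entry_fin, Equiv.symm_apply_apply]
    exact Finset.sum_le_sum_of_subset (Finset.filter_subset _ _)
  unfold upper
  omega

theorem bruteYes_iff : BruteYes d I.n I.t (I.n ^ d) I.entry (2 ^ I.n) ↔ I.MaxYes := by
  classical
  have hweight (mask : ℕ) : (∑ e ∈ Finset.powersetCard d Finset.univ,
      if e ⊆ maskSet I.n mask then I.setEntry e - 1 else 0) = I.weight (maskSet I.n mask) := by
    rw [weight, Finset.sum_filter, ← Finset.sum_subset I.edges_subset]
    · refine Finset.sum_congr rfl fun e he => ?_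
      simp [setEntry, he]
    · intro e _ he
      simp [setEntry, he]
  have hclique (mask : ℕ) : (∑ e ∈ Finset.powersetCard d Finset.univ,
      if e ⊆ maskSet I.n mask then 1 - I.setEntry e else 0) = 0 ↔
        I.IsHyperclique (maskSet I.n mask) := by
    rw [Finset.sum_eq_zero_iff, IsHyperclique]
    refine forall_congr' fun e => ?_
    simp only [Finset.mem_powersetCard, Finset.subset_univ, true_and, setEntry]
    by_cases he : e ∈ I.edges <;> simp [he]
    tauto
  have key (mask : ℕ) : ((∑ k ∈ Finset.range (I.n ^ d),
      if Selected d I.n mask k then 1 - I.entry k else 0) = 0 ∧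
      I.t ≤ ∑ k ∈ Finset.range (I.n ^ d), if Selected d I.n mask k then I.entry k - 1 else 0) ↔
      I.IsHyperclique (maskSet I.n mask) ∧ I.t ≤ I.weight (maskSet I.n mask) := by
    rw [I.sum_selected_eq mask fun x => 1 - x, I.sum_selected_eq mask fun x => x - 1, hweight,
      hclique]
  unfold BruteYes
  simp only [key]
  constructor
  · rintro ⟨mask, -, h⟩
    exact ⟨_, h⟩
  · rintro ⟨S, h⟩
    obtain ⟨mask, hm, rfl⟩ := exists_maskSet_eq S
    exact ⟨mask, hm, h⟩

/-- The tensor determines the hyperedges and their weights, which is all that matters for the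
answer. The instances may still differ in `w` off the hyperedges. -/
theorem exactYes_of_encode_eq {J J' : HypercliqueInstance d} (h : J.encode = J'.encode)
    (hJ : J.ExactYes) : J'.ExactYes := by
  obtain ⟨n, edges, uniform, w, t, ht⟩ := J
  obtain ⟨n', edges', uniform', w', t', ht'⟩ := J'
  simp only [encode, List.cons.injEq] at h
  obtain ⟨rfl, rfl, h⟩ := h
  have hentry := funext_iff.1 (List.ofFn_injective h)
  have hset (e : Finset (Fin n)) (he : e.card = d) :
      (if e ∈ edges then w e + 1 else 0) = if e ∈ edges' then w' e + 1 else 0 := by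
    have := hentry (finFunctionFinEquiv (e.orderEmbOfFin he))
    simpa [tensorEntry] using this
  have hedges : edges = edges' := by
    ext e
    constructor
    · intro he
      have := hset e (uniform e he)
      rw [if_pos he] at this
      by_contra hne
      simp [hne] at this
    · intro he
      have := hset e (uniform' e he)
      rw [if_pos he] at this
      by_contra hne
      simp [hne] at this
  subst hedges
  obtain ⟨S, hS, hw⟩ := hJ
  refine ⟨S, hS, Eq.trans (Finset.sum_congr rfl fun e he => ?_) hw⟩
  have he := (Finset.mem_filter.1 he).1
  have := hset e (uniform e he)
  simp only [he, if_true, Nat.add_right_cancel_iff] at this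
  exact this.symm

theorem exactOracle_encode_iff (J : HypercliqueInstance d) :
    exactOracle d J.encode = true ↔ J.ExactYes := by
  simp only [exactOracle, decide_eq_true_eq]
  exact ⟨fun ⟨_, h, hJ⟩ => exactYes_of_encode_eq h hJ, fun h => ⟨J, rfl, h⟩⟩

/-! ### The family of exact instances -/

/-- The instance of the exact problem with weights rounded down to multiples of `P`, hashed. -/
def hashed (a H Q P g : ℕ) : HypercliqueInstance d where
  n := I.n
  edges := I.edges
  uniform := I.uniform
  w e := mulShift a H Q (I.w e / P) + 1
  t := hashTarget I.t (I.n ^ d) a H Q P g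
  t_pos := Nat.succ_pos _

theorem encode_hashed (a H Q P g : ℕ) :
    (I.hashed a H Q P g).encode = hashWord I.n I.t (I.n ^ d) I.entry a H Q P g := by
  rw [encode_eq, hashWord]
  refine congrArg _ (congrArg _ (List.map_congr_left fun k hk => ?_))
  have hk : k < I.n ^ d := List.mem_range.1 hk
  have h₁ := (I.hashed a H Q P g).entry_fin ⟨k, hk⟩
  have h₂ := I.entry_fin ⟨k, hk⟩
  simp only at h₁ h₂
  rw [h₁, h₂, tensorEntry, tensorEntry, hashEntry]
  by_cases he : Finset.univ.image (finFunctionFinEquiv.symm (⟨k, hk⟩ : Fin (I.n ^ d))) ∈ I.edges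
  · simp only [if_pos he]
    exact if_pos he
  · simp only [if_neg he]
    exact if_neg he

/-- The exponent of the number of hash values. -/
def hashExponent (d : ℕ) : ℕ := 2 * d + 10

/-- The number of rounding levels. -/
def numLevels : ℕ := levels I.t (I.n ^ d) I.entry

/-- The odd multiplier given by a sequence of coins. -/
def multiplier (r : List Bool) : ℕ := 1 + 2 * coinValue (r.take (I.numLevels - 1))

def family (r : List Bool) : List (HypercliqueInstance d) :=
  (List.range I.numLevels).flatMap fun k => (List.range ((I.n ^ d + 1) ^ 3)).map fun g =>
    I.hashed (I.multiplier r) (2 ^ I.numLevels) ((2 ^ I.n) ^ hashExponent d) (2 ^ k) g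

theorem mem_family {r : List Bool} {J : HypercliqueInstance d} : J ∈ I.family r ↔
    ∃ k < I.numLevels, ∃ g < (I.n ^ d + 1) ^ 3, I.hashed (I.multiplier r) (2 ^ I.numLevels)
      ((2 ^ I.n) ^ hashExponent d) (2 ^ k) g = J := by
  simp [family]

theorem map_encode_family (r : List Bool) : (I.family r).map encode =
    hashWords I.n I.t (I.n ^ d) I.entry (I.multiplier r) (2 ^ I.numLevels)
      ((2 ^ I.n) ^ hashExponent d) I.numLevels := by
  simp [family, hashWords, List.map_flatMap, Function.comp_def, encode_hashed]

theorem length_family (r : List Bool) :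
    (I.family r).length = I.numLevels * (I.n ^ d + 1) ^ 3 := by
  simp [family]

/-- The same hyperclique serves; only the level and the three guesses have to be right, and the
family contains every combination. -/
theorem exists_mem_family_exactYes (r : List Bool) (h : I.MaxYes) :
    ∃ J ∈ I.family r, J.ExactYes := by
  obtain ⟨S, hS, hw⟩ := h
  obtain ⟨k, hk, j, hj, hX⟩ := exists_sum_div_eq_divUp_add (I.edges.filter (· ⊆ S)) I.w I.t_pos
    (I.card_edges_filter_le S) hw (I.weight_le_upper S)
  obtain ⟨i, hi, o, ho, hsum, hpos⟩ := exists_sum_mulShift_add_one (a := I.multiplier r)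
    (H := 2 ^ I.numLevels) (Q := (2 ^ I.n) ^ hashExponent d) (I.edges.filter (· ⊆ S))
    (by positivity) fun e => I.w e / 2 ^ k
  rw [hX] at hsum
  have hcard := I.card_edges_filter_le S
  have ho' : 0 < o := by
    refine hpos (Nat.pos_of_ne_zero fun h₀ => ?_)
    rw [Finset.card_eq_zero.1 h₀, Finset.sum_empty] at hX
    have := divUp_pos I.t_pos (P := 2 ^ k) (by positivity)
    omega
  set N := I.n ^ d with hN
  have hG : 0 < N + 1 := Nat.succ_pos N
  have hji : j + (N + 1) * i < (N + 1) * (N + 1) := by nlinarith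
  have hg₁ : (j + (N + 1) * i + (N + 1) * (N + 1) * (o - 1)) % (N + 1) = j := by
    rw [mul_assoc, Nat.add_mul_mod_self_left, Nat.add_mul_mod_self_left,
      Nat.mod_eq_of_lt (by omega)]
  have hg₂ : (j + (N + 1) * i + (N + 1) * (N + 1) * (o - 1)) / (N + 1) % (N + 1) = i := by
    rw [mul_assoc, Nat.add_mul_div_left _ _ hG, Nat.add_mul_div_left _ _ hG,
      Nat.div_eq_of_lt (by omega), zero_add, Nat.add_mul_mod_self_left,
      Nat.mod_eq_of_lt (by omega)]
  have hg₃ : (j + (N + 1) * i + (N + 1) * (N + 1) * (o - 1)) / ((N + 1) * (N + 1)) = o - 1 := by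
    rw [Nat.add_mul_div_left _ _ (by positivity), Nat.div_eq_of_lt hji, zero_add]
  -- The index with base-`(N + 1)` digits `j`, `i`, `o - 1`.
  refine ⟨_, I.mem_family.2 ⟨k, hk, j + (N + 1) * i + (N + 1) * (N + 1) * (o - 1), ?_, rfl⟩,
    S, hS, ?_⟩
  · calc j + (N + 1) * i + (N + 1) * (N + 1) * (o - 1)
        < (N + 1) * (N + 1) + (N + 1) * (N + 1) * (o - 1) := by omega
      _ = (N + 1) * (N + 1) * (o - 1 + 1) := by ring
      _ ≤ (N + 1) * (N + 1) * (N + 1) := Nat.mul_le_mul_left _ (by omega)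
      _ = (N + 1) ^ 3 := by ring
  · refine hsum.trans ?_
    simp only [hashed, hashTarget, ← hN]
    rw [hg₁, hg₂, hg₃, Nat.sub_add_cancel ho']

/-- The differences that the hash function must not bring close to zero. -/
def differences : Finset ℕ :=
  ((Finset.range I.numLevels ×ˢ Finset.range (I.n ^ d + 1)) ×ˢ
    (Finset.univ : Finset (Finset (Fin I.n)))).image (fun x =>
      divUp I.t (2 ^ x.1.1) + x.1.2 - ∑ e ∈ I.edges with e ⊆ x.2, I.w e / 2 ^ x.1.1) |>.filter
    fun D => 0 < D ∧ D < 2 ^ I.numLevels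

theorem card_differences_le :
    I.differences.card ≤ I.numLevels * (I.n ^ d + 1) * 2 ^ I.n := by
  refine (Finset.card_filter_le _ _).trans (Finset.card_image_le.trans ?_)
  simp [Finset.card_product]

/-- In a NO-instance the rounded weight of any hyperclique is strictly below the rounded threshold,
so a hit of the hashed target is a collision up to wraps and offsets. -/
theorem exists_nearMultiple (hno : ¬ I.MaxYes) {r : List Bool} (hr : I.numLevels - 1 ≤ r.length)
    (hyes : ∃ J ∈ I.family r, J.ExactYes) :
    ∃ D ∈ I.differences, NearMultiple (2 ^ (I.numLevels - 1 + 1))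
      ((2 ^ I.n) ^ hashExponent d) (I.n ^ d + 2) D (1 + 2 * coinValue r) := by
  obtain ⟨J, hJ, hyes⟩ := hyes
  obtain ⟨k, hk, g, hg, rfl⟩ := I.mem_family.1 hJ
  set H := 2 ^ I.numLevels with hH
  obtain ⟨S, hS, hw⟩ : ∃ S : Finset (Fin I.n), _ := hyes
  have hlt : ∑ e ∈ I.edges with e ⊆ S, I.w e < I.t := by
    by_contra! hle
    exact hno ⟨S, hS, hle⟩
  have hY := sum_div_lt_divUp (P := 2 ^ k) (I.edges.filter (· ⊆ S)) I.w (by positivity) hlt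
  obtain ⟨i, hi, o, ho, hsum, -⟩ := exists_sum_mulShift_add_one (a := I.multiplier r)
    (H := H) (Q := (2 ^ I.n) ^ hashExponent d) (I.edges.filter (· ⊆ S))
    (by positivity) fun e => I.w e / 2 ^ k
  have hcard := I.card_edges_filter_le S
  have hj : g % (I.n ^ d + 1) < I.n ^ d + 1 := Nat.mod_lt _ (Nat.succ_pos _)
  have ho' : g / ((I.n ^ d + 1) * (I.n ^ d + 1)) < I.n ^ d + 1 := by
    rw [Nat.div_lt_iff_lt_mul (by positivity)]
    calc g < (I.n ^ d + 1) ^ 3 := hg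
      _ = _ := by ring
  have heq := hw.symm.trans hsum
  have hpos : I.numLevels - 1 + 1 = I.numLevels := Nat.sub_add_cancel (by omega)
  -- The true offset is at most `n ^ d` and the guessed one at most `n ^ d + 1`, whence `B = n ^ d +
  -- 2`.
  have hnear := nearMultiple_of_mulShift_eq (B := I.n ^ d + 2) (by positivity) heq
    (by omega) (by omega) (by omega)
  refine ⟨divUp I.t (2 ^ k) + g % (I.n ^ d + 1) - ∑ e ∈ I.edges with e ⊆ S, I.w e / 2 ^ k,
    ?_, ?_⟩
  · refine Finset.mem_filter.2 ⟨Finset.mem_image.2 ⟨((k, g % (I.n ^ d + 1)), S), ?_, rfl⟩,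
      by omega, ?_⟩
    · simp [hk, hj]
    · have h₁ : upper I.t (I.n ^ d) I.entry < H := upper_lt
      have h₂ := divUp_le (t := I.t) (P := 2 ^ k) (by positivity)
      unfold upper at h₁
      omega
  · rw [hpos]
    refine hnear.of_modEq ?_
    have := coinValue_take_modEq r hr
    rwa [hpos] at this

/-! ### Numerical estimates for the union bound. -/

theorem pow_add_two_le {n : ℕ} (hn : 1 ≤ n) : n ^ d + 2 ≤ (2 ^ n) ^ (d + 2) := by
  have h₁ : n ^ d ≤ (2 ^ n) ^ d := Nat.pow_le_pow_left Nat.lt_two_pow_self.le d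
  have h₂ : 2 ≤ 2 ^ n := Nat.le_self_pow (by omega) 2
  have h₃ : 1 ≤ (2 ^ n) ^ d := Nat.one_le_pow _ _ (by positivity)
  rw [pow_add]
  calc n ^ d + 2 ≤ (2 ^ n) ^ d * 4 := by omega
    _ ≤ (2 ^ n) ^ d * (2 ^ n) ^ 2 := Nat.mul_le_mul_left _ (by nlinarith)

theorem card_differences_mul_le (hn : 1 ≤ I.n) (hlev : I.numLevels - 1 ≤ 2 ^ I.n) :
    I.differences.card * (4 * (I.n ^ d + 2)) * 2 ^ I.n ≤ (2 ^ I.n) ^ hashExponent d := by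
  have h₁ := I.card_differences_le
  have h₂ := pow_add_two_le (d := d) hn
  have h₃ : 2 ≤ 2 ^ I.n := Nat.le_self_pow (by omega) 2
  set z := 2 ^ I.n
  have h₄ : I.numLevels ≤ z ^ 2 := by nlinarith [Nat.sub_le_iff_le_add.1 hlev]
  have h₅ : 4 ≤ z ^ 2 := by nlinarith
  -- The exponents add up to `(d + 5) + (d + 4) + 1 = 2 * d + 10`, the value of `hashExponent d`.
  calc I.differences.card * (4 * (I.n ^ d + 2)) * z
      ≤ (z ^ 2 * z ^ (d + 2) * z) * (z ^ 2 * z ^ (d + 2)) * z := by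
        gcongr
        refine h₁.trans ?_
        gcongr
        omega
    _ = z ^ hashExponent d := by
        rw [hashExponent]
        ring

theorem le_coinProb_family (hn : 1 ≤ I.n) (hlev : I.numLevels - 1 ≤ 2 ^ I.n) (hno : ¬ I.MaxYes)
    {T : ℕ} (hT : I.numLevels - 1 ≤ T) :
    1 - (2 : ℝ) ^ (-(1 * (I.n : ℝ))) ≤
      coinProb {r : Fin T → Bool | ∀ J ∈ I.family (List.ofFn r), ¬ J.ExactYes} := by
  refine le_coinProb_of_forall_nearMultiple hT (by positivity) I.differences ?_
    (I.card_differences_mul_le hn hlev) _ ?_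
  · intro D hD
    have h₁ : 0 < I.numLevels := Nat.size_pos.2 (by unfold upper; omega)
    rw [Nat.sub_add_cancel h₁]
    exact (Finset.mem_filter.1 hD).2
  · intro r hr
    refine I.exists_nearMultiple hno (by simpa using hT) ?_
    simpa using hr

/-! ### Sizes -/

theorem length_wordBits (x : List ℕ) :
    (wordBits x).length = (x.map fun a => 2 * a.size + 1).sum := by
  simp [wordBits, List.length_flatMap, Nat.size_eq_bits_len, mul_comm]

theorem length_le_length_wordBits (x : List ℕ) : x.length ≤ (wordBits x).length := by
  rw [length_wordBits]
  induction x with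
  | nil => simp
  | cons a x ih =>
    simp only [List.length_cons, List.map_cons, List.sum_cons]
    omega

/-- The code of `a` has `2 * a.size + 1` bits, so prepending it multiplies the right side by enough
to absorb the summand `a + 1`. This bounds `upper`, and hence the number of levels, through the
bitsize. -/
theorem sum_add_one_le_two_pow (x : List ℕ) :
    (x.map fun a => a + 1).sum ≤ 2 ^ (wordBits x).length := by
  rw [length_wordBits]
  induction x with
  | nil => simp
  | cons a x ih =>
    simp only [List.map_cons, List.sum_cons]
    set B := (x.map fun a => 2 * a.size + 1).sum
    have h₁ : a < 2 ^ a.size := Nat.lt_size_self a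
    have h₂ : 1 ≤ 2 ^ B := Nat.one_le_two_pow
    have h₃ : 2 ^ (2 * a.size + 1 + B) = 2 * 2 ^ a.size * 2 ^ a.size * 2 ^ B := by ring
    have h₄ : 1 ≤ 2 ^ a.size := Nat.one_le_two_pow
    have h₅ : 2 ^ a.size * 2 ^ B ≤ 2 ^ a.size * 2 ^ a.size * 2 ^ B :=
      Nat.mul_le_mul_right _ (Nat.le_mul_of_pos_left _ h₄)
    rw [h₃]
    nlinarith

theorem pow_add_two_le_bitsize : I.n ^ d + 2 ≤ I.bitsize := by
  have := length_le_length_wordBits I.encode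
  simp only [encode_eq, List.length_cons, List.length_map, List.length_range] at this
  rw [bitsize, encode_eq]
  omega

theorem upper_le_two_pow_bitsize : upper I.t (I.n ^ d) I.entry ≤ 2 ^ I.bitsize := by
  have := sum_add_one_le_two_pow I.encode
  have hsum : ((List.range (I.n ^ d)).map fun k => I.entry k + 1).sum =
      ∑ k ∈ Finset.range (I.n ^ d), (I.entry k + 1) := rfl
  rw [encode_eq] at this
  simp only [List.map_cons, List.sum_cons, List.map_map, Function.comp_def, hsum,
    Finset.sum_add_distrib, Finset.sum_const, Finset.card_range, smul_eq_mul, mul_one] at this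
  rw [bitsize, encode_eq]
  unfold upper
  omega

theorem numLevels_le : I.numLevels ≤ I.bitsize + 1 := by
  refine Nat.size_le.2 (I.upper_le_two_pow_bitsize.trans_lt ?_)
  exact Nat.pow_lt_pow_right one_lt_two (Nat.lt_succ_self _)

theorem le_bitsize (hd : 2 ≤ d) : I.n ≤ I.bitsize := by
  have h₁ := Nat.le_self_pow (show d ≠ 0 by omega) I.n
  have h₂ := I.pow_add_two_le_bitsize
  omega

/-- There are `n ^ d + 2 ≤ 3 * n ^ d` numbers, each at most `(n ^ d + 2) * 2 * Q`, hence of `O(n)`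
bits. -/
theorem bitsize_hashed_le (hn : 1 ≤ I.n) {a H P g : ℕ} (hH : 0 < H)
    (hg : g < (I.n ^ d + 1) ^ 3) :
    (I.hashed a H ((2 ^ I.n) ^ hashExponent d) P g).bitsize ≤
      3 * (2 * (3 * d + 14) + 3) * I.n ^ (d + 1) := by
  have hN := pow_add_two_le (d := d) hn
  have hn' : I.n < 2 ^ I.n := Nat.lt_two_pow_self
  have hz : 2 ≤ 2 ^ I.n := Nat.le_self_pow (by omega) 2
  have hN1 : 1 ≤ I.n ^ d := Nat.one_le_pow _ _ hn
  have hQ0 : 0 < (2 ^ I.n) ^ hashExponent d := by positivity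
  have hle : (2 ^ I.n) ^ (d + 2) * (2 * (2 ^ I.n) ^ hashExponent d) ≤
      2 ^ (I.n * (3 * d + 13)) := by
    calc _ ≤ (2 ^ I.n) ^ (d + 2) * (2 ^ I.n * (2 ^ I.n) ^ hashExponent d) := by gcongr
      _ = _ := by
        rw [hashExponent, ← pow_succ', ← pow_add, ← pow_mul]
        ring_nf
  have hzQ : 2 ^ I.n ≤ (2 ^ I.n) ^ hashExponent d := Nat.le_self_pow (by simp [hashExponent]) _
  set Q := (2 ^ I.n) ^ hashExponent d
  have hmul (x : ℕ) := mulShift_lt a x hH hQ0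
  have hbound : ∀ x ∈ hashWord I.n I.t (I.n ^ d) I.entry a H Q P g,
      x ≤ 2 ^ (I.n * (3 * d + 13)) := by
    refine fun x hx => le_trans ?_ ((Nat.mul_le_mul_right _ hN).trans hle)
    rw [hashWord, List.mem_cons, List.mem_cons, List.mem_map] at hx
    rcases hx with rfl | rfl | ⟨k, -, rfl⟩
    · nlinarith
    · have h₁ := hmul (divUp I.t P + g % (I.n ^ d + 1))
      have h₂ : g / (I.n ^ d + 1) % (I.n ^ d + 1) < I.n ^ d + 1 := Nat.mod_lt _ (Nat.succ_pos _)
      have h₃ : g / ((I.n ^ d + 1) * (I.n ^ d + 1)) < I.n ^ d + 1 := by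
        rw [Nat.div_lt_iff_lt_mul (by positivity)]
        calc g < (I.n ^ d + 1) ^ 3 := hg
          _ = _ := by ring
      have h₄ := Nat.mul_le_mul_right Q (Nat.lt_succ_iff.1 h₂)
      unfold hashTarget
      nlinarith
    · have h₁ := hmul ((I.entry k - 1) / P)
      unfold hashEntry
      split_ifs
      · omega
      · nlinarith
  rw [bitsize, encode_hashed, length_wordBits]
  refine (List.sum_le_card_nsmul _ (2 * (I.n * (3 * d + 13) + 1) + 1) ?_).trans ?_
  · rw [List.forall_mem_map]
    intro x hx
    have : x.size ≤ I.n * (3 * d + 13) + 1 :=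
      Nat.size_le.2 ((hbound x hx).trans_lt (Nat.pow_lt_pow_right one_lt_two (Nat.lt_succ_self _)))
    omega
  · simp only [hashWord, List.length_map, List.length_cons, List.length_range, smul_eq_mul]
    calc (I.n ^ d + 1 + 1) * (2 * (I.n * (3 * d + 13) + 1) + 1)
        ≤ (3 * I.n ^ d) * (I.n * (2 * (3 * d + 14) + 3)) := by
          refine Nat.mul_le_mul (by omega) ?_
          nlinarith
      _ = _ := by ring

theorem bitsize_family_le (hn : 1 ≤ I.n) {r : List Bool} {J : HypercliqueInstance d}
    (hJ : J ∈ I.family r) : J.bitsize ≤ 3 * (2 * (3 * d + 14) + 3) * I.n ^ (d + 1) := by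
  obtain ⟨k, -, g, hg, rfl⟩ := I.mem_family.1 hJ
  exact I.bitsize_hashed_le hn (by positivity) hg

theorem length_family_le (r : List Bool) : (I.family r).length ≤ (I.bitsize + 1) ^ 4 := by
  have h₁ := I.numLevels_le
  have h₂ := I.pow_add_two_le_bitsize
  rw [length_family, pow_succ' _ 3]
  gcongr
  omega

/-- A fixed YES-instance of the exact problem. -/
def single (d : ℕ) : HypercliqueInstance d where
  n := d
  edges := {Finset.univ}
  uniform := by simp
  w _ := 1
  t := 1
  t_pos := one_pos

theorem exactYes_single (d : ℕ) : (single d).ExactYes := by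
  refine ⟨(Finset.univ : Finset (Fin d)), fun X _ hX => ?_, ?_⟩
  · exact Finset.mem_singleton.2 ((Finset.card_eq_iff_eq_univ X).1 (hX.trans (Fintype.card_fin d).symm))
  · change ∑ e ∈ ({Finset.univ} : Finset (Finset (Fin d))) with e ⊆ Finset.univ, 1 = 1
    simp [Finset.filter_singleton]

end HypercliqueInstance

/-! ### The reduction and the kernel -/

namespace HypercliqueProg

open RamExpr RamProg

def writeList : List ℕ → RamProg
  | [] => skip
  | a :: l => seq (writeOut (const a)) (writeList l)

theorem wp_writeList {O : List ℕ → Bool} {V R : ℕ} (l : List ℕ) {s : RamState}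
    {Q : RamState → Prop} (hQ : Q { s with output := s.output ++ l }) :
    (writeList l).Wp O V R s Q := by
  induction l generalizing s with
  | nil => exact wp_skip (by simpa using hQ)
  | cons a l ih => exact wp_seq (wp_writeOut (ih (by simpa [eval] using hQ)))

/-- The algorithm behind the disjunctive reduction. -/
def reductionProg (d : ℕ) : RamProg :=
  mainProg d (HypercliqueInstance.hashExponent d) skip skip
    (cond (reg 14) (writeList (HypercliqueInstance.single d).encode) skip)

/-- The algorithm behind the Turing kernel. -/
def kernelProg (d : ℕ) : RamProg :=
  mainProg d (HypercliqueInstance.hashExponent d)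
    (seq (query 16) (assign 14 (flag (.add (reg 14) (reg 16)))))
    (writeOut (reg 14)) (writeOut (reg 14))

theorem collects_skip (O : List ℕ → Bool) (V R : ℕ) :
    Collects O V R skip fun L out qs _ => out = L.flatten ∧ qs = [] := by
  rintro L w out s hout ⟨rfl, hq⟩
  exact wp_skip ⟨⟨by simp [hout], hq⟩, rfl, fun _ _ _ => rfl⟩

/-- Register 14 accumulates the disjunction of the answers, and each query empties the output tape
for the next instance. -/
theorem collects_query (O : List ℕ → Bool) {V R : ℕ} (hV : 1 ≤ V) :
    Collects O V R (seq (query 16) (assign 14 (flag (.add (reg 14) (reg 16)))))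
      fun L out qs v => out = [] ∧ qs = L ∧ v = (L.any O).toNat := by
  rintro L w out s hout ⟨rfl, hq, hv⟩
  rw [List.nil_append] at hout
  refine wp_seq (wp_query (wp_assign ?_ ⟨⟨rfl, by simp [hq, hout], ?_⟩, rfl, ?_⟩))
  · rw [eval_flag]
    split_ifs <;> omega
  · simp only [eval_flag, eval, RamState.setReg_reg, hv, hout]
    cases h₁ : L.any O <;> cases h₂ : O w <;> simp [h₁, h₂]
  · intro i h14 h16
    simp [h14, h16]

end HypercliqueProg

namespace HypercliqueInstance

open HypercliqueProg RamProg

variable {d : ℕ} (I : HypercliqueInstance d)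

/-- The bounds become concrete: numbers have linearly many bits in the bitsize, and each loop makes
at most cubically many rounds. -/
theorem wp_mainProg {O : List ℕ → Bool} (hd : 2 ≤ d) (hn : 1 ≤ I.n) (r : List Bool)
    {fin hashEnd bruteEnd : RamProg} {E : List (List ℕ) → List ℕ → List (List ℕ) → ℕ → Prop}
    (hfin : Collects O (2 ^ (5 * I.bitsize + 1)) ((I.bitsize + 1) ^ 3) fin E) (hE : E [] [] [] 0)
    {Q : RamState → Prop}
    (hhash : I.numLevels - 1 ≤ 2 ^ I.n → ∀ s,
      E ((I.family r).map encode) s.output s.queries (s.reg 14) →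
      hashEnd.Wp O (2 ^ (5 * I.bitsize + 1)) ((I.bitsize + 1) ^ 3) s Q)
    (hbrute : 2 ^ I.n < I.numLevels - 1 → ∀ s,
      (s.reg 14 = 0 ∧ ¬ I.MaxYes ∨ s.reg 14 = 1 ∧ I.MaxYes) → s.output = [] → s.queries = [] →
      bruteEnd.Wp O (2 ^ (5 * I.bitsize + 1)) ((I.bitsize + 1) ^ 3) s Q) :
    (mainProg d (hashExponent d) fin hashEnd bruteEnd).Wp O (2 ^ (5 * I.bitsize + 1))
      ((I.bitsize + 1) ^ 3) (.init I.encode r) Q := by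
  have hN := I.pow_add_two_le_bitsize
  have hlev := I.numLevels_le
  have hnb := I.le_bitsize hd
  have hself : I.bitsize + 1 ≤ (I.bitsize + 1) ^ 3 := Nat.le_self_pow (by norm_num) _
  have hG : (I.n ^ d + 1) ^ 3 ≤ (I.bitsize + 1) ^ 3 := Nat.pow_le_pow_left (by omega) 3
  have hGV : (I.n ^ d + 1) ^ 3 ≤ 2 ^ (5 * I.bitsize + 1) := by
    calc (I.n ^ d + 1) ^ 3 ≤ (2 ^ I.bitsize) ^ 3 :=
          Nat.pow_le_pow_left (le_trans (by omega) Nat.lt_two_pow_self.le) 3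
      _ = 2 ^ (I.bitsize * 3) := (pow_mul _ _ _).symm
      _ ≤ _ := Nat.pow_le_pow_right two_pos (by omega)
  rw [encode_eq]
  refine HypercliqueProg.wp_mainProg I.t_pos hn rfl ?_ ?_ hGV (by omega) ?_ hG r hfin hE ?_ ?_
  · exact Nat.pow_le_pow_right two_pos (by omega)
  · change 2 ^ I.numLevels ≤ _
    exact Nat.pow_le_pow_right two_pos (by omega)
  · change I.numLevels ≤ _
    omega
  · rw [map_encode_family] at hhash
    exact hhash
  · rw [bruteYes_iff]
    exact hbrute

end HypercliqueInstance

theorem RamProg.Wp.runsTo {O : List ℕ → Bool} {V R T : ℕ} {p : RamProg} {x y : List ℕ}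
    {r : List Bool} {Q : List (List ℕ)} (hV : 2 ≤ V) (hT : p.costBound (V.size + 1) R ≤ T)
    (h : p.Wp O V R (.init x r) fun s => s.output = y ∧ s.queries = Q) :
    p.RunsTo O x r T y Q :=
  let ⟨s, c, h₁, h₂, _, h₃⟩ := h ⟨hV, fun _ => Nat.zero_le _, fun _ _ => Nat.zero_le _⟩
  ⟨s, c, h₁, h₂.trans hT, h₃⟩

theorem exists_timeBound (d : ℕ) (p : RamProg) : ∃ T : Polynomial ℕ,
    ∀ I : HypercliqueInstance d, I.numLevels - 1 ≤ T.eval I.bitsize ∧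
      p.costBound ((2 ^ (5 * I.bitsize + 1)).size + 1) ((I.bitsize + 1) ^ 3) ≤
        T.eval I.bitsize := by
  obtain ⟨T, hT⟩ := p.exists_polynomial_costBound (.C 5 * .X + 3) ((.X + 1) ^ 3)
  -- The summand `X` provides enough coins, as `numLevels - 1` is at most the bitsize.
  refine ⟨T + .X, fun I => ⟨?_, ?_⟩⟩
  · have := I.numLevels_le
    rw [Polynomial.eval_add, Polynomial.eval_X]
    omega
  · rw [Polynomial.eval_add, hT, Nat.size_pow]
    simp [add_assoc]

theorem coinProb_univ (m : ℕ) : coinProb (Set.univ : Set (Fin m → Bool)) = 1 := by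
  simp [coinProb, Set.ncard_univ]

theorem one_sub_le_coinProb_univ (m n : ℕ) :
    1 - (2 : ℝ) ^ (-(1 * (n : ℝ))) ≤ coinProb (Set.univ : Set (Fin m → Bool)) := by
  rw [coinProb_univ, sub_le_self_iff]
  positivity

open HypercliqueProg RamProg HypercliqueInstance in
theorem hasDisjunctiveReduction {d : ℕ} (hd : 2 ≤ d) : HasDisjunctiveReduction d := by
  classical
  obtain ⟨T, hT⟩ := exists_timeBound d (reductionProg d)
  -- The bitsize of `single d` enters the constant because this fixed instance is the output when
  -- the search succeeds.
  refine ⟨reductionProg d, T, (.X + 1) ^ 4,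
    3 * (2 * (3 * d + 14) + 3) + (single d).bitsize, 1, one_pos, fun I hn => ?_⟩
  obtain ⟨hcoins, hcost⟩ := hT I
  have hV : 2 ≤ 2 ^ (5 * I.bitsize + 1) := Nat.le_self_pow (by omega) 2
  have hpow : 1 ≤ I.n ^ (d + 1) := Nat.one_le_pow _ _ hn
  rcases le_or_gt (I.numLevels - 1) (2 ^ I.n) with hlev | hlev
  · refine ⟨fun r => I.family (List.ofFn r), fun r => ?_, fun r J hJ => ?_, fun r => ?_,
      fun h r => I.exists_mem_family_exactYes _ h,
      fun h => I.le_coinProb_family hn hlev h hcoins⟩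
    · refine RamProg.Wp.runsTo hV hcost (I.wp_mainProg hd hn _ (collects_skip _ _ _)
        ⟨rfl, rfl⟩ ?_ fun h => absurd h (not_lt.2 hlev))
      rintro _ s ⟨hout, hq⟩
      exact wp_skip ⟨by rw [hout, List.flatMap_def], hq⟩
    · have := I.bitsize_family_le hn hJ
      rw [add_mul]
      omega
    · simpa using I.length_family_le (List.ofFn r)
  · refine ⟨fun _ => if I.MaxYes then [single d] else [], fun r => ?_, fun r J hJ => ?_,
      fun r => ?_, fun h r => ⟨single d, by simp [h], exactYes_single d⟩, fun h => ?_⟩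
    · refine RamProg.Wp.runsTo hV hcost (I.wp_mainProg hd hn _ (collects_skip _ _ _)
        ⟨rfl, rfl⟩ (fun h => absurd hlev (not_lt.2 h)) ?_)
      rintro _ s (⟨h14, h⟩ | ⟨h14, h⟩) hout hq
      · exact wp_cond (fun h' => absurd h14 h') fun _ => wp_skip ⟨by simp [hout, h], hq⟩
      · refine wp_cond (fun _ => wp_writeList _ ⟨by simp [hout, h], hq⟩) fun h' => ?_
        exact absurd (h14.symm.trans h') one_ne_zero
    · split_ifs at hJ with h
      · rw [List.mem_singleton.1 hJ, add_mul]
        have := Nat.le_mul_of_pos_right (single d).bitsize hpow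
        omega
      · simp at hJ
    · have : 1 ≤ (I.bitsize + 1) ^ 4 := Nat.one_le_pow _ _ (Nat.succ_pos _)
      split_ifs <;> simp [this]
    · simpa [h] using one_sub_le_coinProb_univ (T.eval I.bitsize) I.n

open HypercliqueProg RamProg HypercliqueInstance in
theorem hasRandomizedTuringKernel {d : ℕ} (hd : 2 ≤ d) : HasRandomizedTuringKernel d := by
  classical
  obtain ⟨T, hT⟩ := exists_timeBound d (kernelProg d)
  refine ⟨kernelProg d, T, 3 * (2 * (3 * d + 14) + 3), 1, one_pos, fun I hn => ?_⟩
  obtain ⟨hcoins, hcost⟩ := hT I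
  have hV : 2 ≤ 2 ^ (5 * I.bitsize + 1) := Nat.le_self_pow (by omega) 2
  have hcollects := collects_query (exactOracle d) (R := (I.bitsize + 1) ^ 3)
    (one_le_two.trans hV)
  rcases le_or_gt (I.numLevels - 1) (2 ^ I.n) with hlev | hlev
  · have hany (r : List Bool) : ((I.family r).map encode).any (exactOracle d) = true ↔
        ∃ J ∈ I.family r, J.ExactYes := by
      simp [exactOracle_encode_iff]
    refine ⟨fun r => ((I.family (List.ofFn r)).map encode).any (exactOracle d),
      fun r => I.family (List.ofFn r), fun r => ?_, fun r J hJ => I.bitsize_family_le hn hJ,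
      fun h r => (hany _).2 (I.exists_mem_family_exactYes _ h), fun h => ?_⟩
    · refine RamProg.Wp.runsTo hV hcost (I.wp_mainProg hd hn _ hcollects
        ⟨rfl, rfl, rfl⟩ ?_ fun h => absurd h (not_lt.2 hlev))
      rintro _ s ⟨hout, hq, h14⟩
      exact wp_writeOut ⟨by simp only [hout, List.nil_append, RamExpr.eval, h14], hq⟩
    · convert I.le_coinProb_family hn hlev h hcoins using 3
      funext r
      beta_reduce
      rw [← Bool.not_eq_true, hany]
      simp
  -- After exhaustive search the answer is certain and no query is asked.
  · refine ⟨fun _ => decide I.MaxYes, fun _ => [], fun r => ?_, by simp, by simp +contextual,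
      fun h => ?_⟩
    · refine RamProg.Wp.runsTo hV hcost (I.wp_mainProg hd hn _ hcollects
        ⟨rfl, rfl, rfl⟩ (fun h => absurd hlev (not_lt.2 h)) ?_)
      rintro _ s h hout hq
      refine wp_writeOut ⟨?_, hq⟩
      rcases h with ⟨h14, h⟩ | ⟨h14, h⟩ <;> simp [hout, h, RamExpr.eval, h14]
    · simpa [h] using one_sub_le_coinProb_univ (T.eval I.bitsize) I.n

theorem mainTheorem6 (d : ℕ) (hd : 2 ≤ d) :
    HasDisjunctiveReduction d ∧ HasRandomizedTuringKernel d :=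
  ⟨hasDisjunctiveReduction hd, hasRandomizedTuringKernel hd⟩
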